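/- Let $G$ be a simple undirected graph all of whose vertices have finite degree (the degrees need not be bounded), with vertex set $V$, and let $L_2(G)$ be the Hilbert space of square-summable functions $f:V\to\mathbb{C}$. Let $L$ be the Laplace operator $Lf(v)=\sum_{u\sim v}(f(v)-f(u))$, a nonnegative self-adjoint operator on the domain $\{f\in L_2(G): Lf\in L_2(G)\}$, and let $L^k$ have the domain $\{f: L^jf\in L_2(G),\ 0\le j\le k\}$. Let $(e^{itL})_{t\in\mathbb{R}}$ be the strongly continuous one-parameter unitary group with generator $iL$. For $\omega>0$ let $PW_\omega(L)$ be the space of those $f\in L_2(G)$ whose spectral measure with respect to $L$ (the finite measure $\mu$ on $\mathbb{R}$ with $\langle e^{itL}f,f\rangle=\int e^{it\lambda}\,d\mu(\lambda)$ for all $t\in\mathbb{R}$) is concentrated on $[0,\omega]$; equivalently, the spectral Fourier transform of $f$ is supported in $[0,\omega]$. Put $E(f,\omega)=\inf_{g\in PW_\omega(L)}\|f-g\|$. For integers $m\ge 0$ and real $s$ put $$\Delta^m_sf=\sum_{j=0}^m(-1)^{m+j}\binom{m}{j}e^{ijsL}f,\qquad \Omega_m(f,s)=\sup_{|\tau|\le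 s}\|\Delta^m_\tau f\|\quad(s\ge 0).$$ Let $n$ be an even natural number and $m,k$ integers with $n\ge m+2$ and $0\le k\le m$. Let $$h(t)=a\left(\frac{\sin(t/n)}{t}\right)^n,\qquad a=\left(\int_{-\infty}^{\infty}\left(\frac{\sin(t/n)}{t}\right)^n dt\right)^{-1},$$ and $$\mathcal{P}_h^{\omega,m}f=\int_{-\infty}^{\infty}h(t)\left\{(-1)^{m-1}\Delta^m_{t/\omega}f+f\right\}dt .$$ Then the group $(e^{itL})_{t\in\mathbb{R}}$ exists, and the integral $$C^h_{m,k}=\int_{-\infty}^{\infty}h(t)\,|t|^k(1+|t|)^{m-k}\,dt$$ converges and is positive. For every $\omega>0$ and every $f\in L_2(G)$, the integral defining $\mathcal{P}_h^{\omega,m}f$ converges (as a Bochner integral in $L_2(G)$), $\mathcal{P}_h^{\omega,m}f\in PW_\omega(L)$, and $$E(f,\omega)\le\left\|\mathcal{P}_h^{\omega,m}f-f\right\|.$$ If moreover $f$ belongs to the domain of $L^k$, then $$\left\|\mathcal{P}_h^{\omega,m}f-f\right\|\le\frac{C^h_{m,k}}{\omega^k}\,\Omega_{m-k}\!\left(L^kf,\frac1\omega\right).$$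 -/

import Mathlib

open MeasureTheory Complex

/-! # Laplacian, Schrodinger group and Paley-Wiener spaces of a locally finite graph -/

/-- The Hilbert space `L₂(G)` of square summable complex functions on the vertex set. -/
abbrev GraphL2 (V : Type*) : Type _ := lp (fun _ : V => ℂ) 2

namespace SimpleGraph

variable {V : Type*} (G : SimpleGraph V) [G.LocallyFinite]

/-- The expression `(L f)(v) = ∑_{u ∼ v} (f v - f u)`. All degrees are finite, so it makes sense
for every function on the vertices, square summable or not. -/
def laplaceFun (f : V → ℂ) (v : V) : ℂ :=
  ∑ u ∈ G.neighborFinset v, (f v - f u)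

/-- The domain of the `k`-th power of the Laplace operator `L` of `L₂(G)`. The (in general
unbounded) self-adjoint operator `L` has the domain `{f ∈ L₂(G) | L f ∈ L₂(G)}`, hence `L ^ k` has
the domain `{f | L ^ j f ∈ L₂(G) for all j ≤ k}`. It is all of `L₂(G)` when the degrees are
bounded. -/
def laplaceDomain (k : ℕ) : Set (GraphL2 V) :=
  {f | ∀ j ≤ k, Memℓp (G.laplaceFun^[j] (f : V → ℂ)) 2}

/-- The vector `L ^ k f` for `f` in the domain of `L ^ k`. -/
def laplacePow (k : ℕ) (f : GraphL2 V) (hf : f ∈ G.laplaceDomain k) : GraphL2 V :=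
  ⟨G.laplaceFun^[k] (f : V → ℂ), hf k le_rfl⟩

/-- `U` is the strongly continuous one-parameter unitary group generated by `iL`, that is
`U t = e^{itL}`. The last field says that the generator is exactly `iL`: the orbit of `f` is
differentiable at `0`, with derivative `i g`, if and only if `f` is in the domain of `L` and
`L f = g` (as `g` is in `L₂(G)`, the pointwise equation `g = L f` says both). -/
structure IsSchrodingerGroup (U : ℝ → GraphL2 V →L[ℂ] GraphL2 V) : Prop where
  map_zero : U 0 = 1
  map_add : ∀ s t : ℝ, U (s + t) = U s * U t
  norm_map : ∀ (t : ℝ) (f : GraphL2 V), ‖U t f‖ = ‖f‖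
  continuous : ∀ f : GraphL2 V, Continuous fun t : ℝ => U t f
  generator : ∀ f g : GraphL2 V,
    HasDerivAt (fun t : ℝ => U t f) (I • g) 0 ↔ (g : V → ℂ) = G.laplaceFun (f : V → ℂ)

/-- The Schrodinger group `t ↦ e^{itL}`: the (unique) unitary group with generator `iL`. -/
noncomputable def schrodingerGroup : ℝ → GraphL2 V →L[ℂ] GraphL2 V :=
  Classical.epsilon G.IsSchrodingerGroup

/-- The finite measure `μ` is the spectral measure of `f` with respect to `L`:
`⟨e^{itL} f, f⟩ = ∫ e^{itλ} dμ(λ)` for all real `t` (the inner product of Mathlib is linear in the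
second argument). A finite measure is determined by its Fourier transform. If `a` is the spectral
Fourier transform of `f`, in a direct integral over a measure `m`, then
`dμ(λ) = ‖a(λ)‖² dm(λ)`. -/
def IsSpectralMeasure (f : GraphL2 V) (μ : Measure ℝ) : Prop :=
  IsFiniteMeasure μ ∧
    ∀ t : ℝ, inner ℂ f (G.schrodingerGroup t f) = ∫ x : ℝ, exp (I * (t : ℂ) * (x : ℂ)) ∂μ

/-- The Paley-Wiener space `PW_ω(L)`: the spectral Fourier transform of `f` is supported in
`[0, ω]`, that is, the spectral measure of `f` does not charge the complement of `[0, ω]`. -/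
def paleyWiener (ω : ℝ) : Set (GraphL2 V) :=
  {f | ∃ μ : Measure ℝ, G.IsSpectralMeasure f μ ∧ μ (Set.Icc 0 ω)ᶜ = 0}

/-- Best approximation `E(f, ω) = inf {‖f - g‖ : g ∈ PW_ω(L)}`. -/
noncomputable def bestApprox (f : GraphL2 V) (ω : ℝ) : ℝ :=
  ⨅ g : G.paleyWiener ω, ‖f - (g : GraphL2 V)‖

/-- The difference `Δ^m_s f = ∑_{j=0}^m (-1)^{m+j} C(m,j) e^{ijsL} f`. -/
noncomputable def schrodingerDiff (m : ℕ) (s : ℝ) (f : GraphL2 V) : GraphL2 V :=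
  ∑ j ∈ Finset.range (m + 1),
    ((-1 : ℂ) ^ (m + j) * (m.choose j : ℂ)) • G.schrodingerGroup ((j : ℝ) * s) f

/-- The modulus of continuity `Ω_m(f, s) = sup_{|τ| ≤ s} ‖Δ^m_τ f‖`. -/
noncomputable def schrodingerModulus (m : ℕ) (f : GraphL2 V) (s : ℝ) : ℝ :=
  ⨆ τ : {τ : ℝ // |τ| ≤ s}, ‖G.schrodingerDiff m (τ : ℝ) f‖

/-- The kernel `h(t) = a (sin(t/n)/t)^n` with `a = (∫ (sin(t/n)/t)^n dt)⁻¹`. -/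
noncomputable def jacksonKernel (n : ℕ) (t : ℝ) : ℝ :=
  (∫ s : ℝ, (Real.sin (s / n) / s) ^ n)⁻¹ * (Real.sin (t / n) / t) ^ n

/-- The integrand `h(t) |t|^k (1 + |t|)^{m-k}` of the constant. -/
noncomputable def jacksonConstIntegrand (n m k : ℕ) (t : ℝ) : ℝ :=
  jacksonKernel n t * |t| ^ k * (1 + |t|) ^ (m - k)

/-- The constant `C^h_{m,k} = ∫ h(t) |t|^k (1 + |t|)^{m-k} dt`, for `k ≤ m`. -/
noncomputable def jacksonConst (n m k : ℕ) : ℝ :=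
  ∫ t : ℝ, jacksonConstIntegrand n m k t

/-- The integrand `h(t) {(-1)^{m-1} Δ^m_{t/ω} f + f}` of the filter, where the sign is written
`(-1)^{m+1}`. -/
noncomputable def filterIntegrand (n m : ℕ) (ω : ℝ) (f : GraphL2 V) (t : ℝ) : GraphL2 V :=
  (jacksonKernel n t : ℂ) • ((-1 : ℂ) ^ (m + 1) • G.schrodingerDiff m (t / ω) f + f)

/-- The filter `P_h^{ω,m} f = ∫ h(t) {(-1)^{m-1} Δ^m_{t/ω} f + f} dt`. -/
noncomputable def filterOp (n m : ℕ) (ω : ℝ) (f : GraphL2 V) : GraphL2 V :=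
  ∫ t : ℝ, G.filterIntegrand n m ω f t

end SimpleGraph

/-! `L` may be unbounded, so the work is done with `R = (1 + L)⁻¹`. On finitely supported `c` one
has `⟨(1 + L)c, c⟩ ≥ ‖c‖²`, and the vectors `(1 + L)c` are dense because a square summable solution
of `Lf = -f` violates the maximum principle (`eq_zero_of_laplaceFun_eq_neg`). Hence `R` exists as a
positive injective contraction, and its range is the whole maximal domain of `L`. The continuous
functional calculus of `R`, with `λ = 1/r - 1`, yields `e^{itL}`
(`isSchrodingerGroup_resolventGroup`) and spectral measures on `[0, ∞)`
(`exists_measure_resolventGroup`).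

Up to a constant, `h` is the Fourier transform of the `n`-fold convolution of the indicator of
`[-1/n, 1/n]`, so `∫ h(t) e^{itx} dt = 0` for `x > 1`. In the filter, the term `j = 0` of the
difference cancels `f`. What remains are averages of `e^{ibL}f` against dilates of `h` whose
transforms vanish beyond `ω/j ≤ ω`. Averaging against `κ` multiplies the spectral measure by the
squared modulus of the transform of `κ`, so the filter lands in `PW_ω(L)`
(`filterOp_mem_paleyWiener`), which bounds `E(f, ω)`.

Since `∫ h = 1`, the error is, up to sign, the `h`-average of `Δ^m_{t/ω} f`, and `Δ^m_s = (e^{isL} -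
1)^m`. Each of `k` factors is traded for `|s|` and one power of `L`; the other `m - k` are reduced
to a step at most `1/ω` at the cost `(1 + |t|)^{m-k}` (`norm_schrodingerDiff_div_le_of_mem`). -/

/-! ### Finitely supported vectors and pointwise evaluation -/

open Classical in
/-- The indicator function of a vertex. -/
noncomputable def vertexDelta {V : Type*} (v : V) : GraphL2 V := lp.single 2 v (1 : ℂ)

theorem inner_vertexDelta {V : Type*} (v : V) (f : GraphL2 V) : inner ℂ (vertexDelta v) f = f v := by
  classical
  rw [vertexDelta, lp.inner_single_left]
  simp

theorem graphL2_continuous_apply {V : Type*} (v : V) : Continuous fun f : GraphL2 V => f v := by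
  simp_rw [← inner_vertexDelta]
  fun_prop

/-- The vector with a given finitely supported family of values. -/
noncomputable def ofFinsupp (V : Type*) : (V →₀ ℂ) →ₗ[ℂ] GraphL2 V :=
  Finsupp.linearCombination ℂ vertexDelta

theorem inner_ofFinsupp {V : Type*} (f : GraphL2 V) (c : V →₀ ℂ) :
    inner ℂ (ofFinsupp V c) f = ∑ v ∈ c.support, starRingEnd ℂ (c v) * f v := by
  simp only [ofFinsupp, Finsupp.linearCombination_apply, Finsupp.sum, sum_inner, inner_smul_left,
    inner_vertexDelta]

theorem ofFinsupp_apply {V : Type*} (c : V →₀ ℂ) (w : V) : (ofFinsupp V c : GraphL2 V) w = c w := by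
  classical
  rw [← inner_vertexDelta, ← inner_conj_symm, inner_ofFinsupp]
  simp [vertexDelta, lp.single_apply, Pi.single_apply]
  split_ifs with h <;> simp [h]

/-- A square summable function attains the maximum of its modulus. -/
theorem exists_norm_apply_max {V : Type*} (f : GraphL2 V) (v₀ : V) (hv₀ : f v₀ ≠ 0) :
    ∃ v, f v ≠ 0 ∧ ∀ w, ‖f w‖ ≤ ‖f v‖ := by
  have hs : Summable fun v => ‖f v‖ ^ (2 : ENNReal).toReal := (lp.memℓp f).summable (by norm_num)
  have hpos : 0 < ‖f v₀‖ ^ (2 : ENNReal).toReal := Real.rpow_pos_of_pos (norm_pos_iff.2 hv₀) _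
  have hev := hs.tendsto_cofinite_zero.eventually_lt_const hpos
  have hfin : {v | ‖f v₀‖ ≤ ‖f v‖}.Finite := by
    refine (Filter.eventually_cofinite.1 hev).subset fun v hv => ?_
    simp only [Set.mem_ofPred_eq, not_lt] at hv ⊢
    exact Real.rpow_le_rpow (norm_nonneg _) hv (by norm_num)
  obtain ⟨v, hv, hmax⟩ := Set.exists_max_image _ (fun v => ‖f v‖) hfin ⟨v₀, le_refl ‖f v₀‖⟩
  refine ⟨v, fun h => hv₀ ?_, fun w => ?_⟩
  · have : ‖f v₀‖ ≤ ‖f v‖ := hv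
    rw [h, norm_zero] at this
    exact norm_le_zero_iff.1 this
  · by_cases hw : ‖f v₀‖ ≤ ‖f w‖
    · exact hmax w hw
    · exact (not_le.1 hw).le.trans hv

/-! ### The Laplacian on functions and the resolvent `(1 + L)⁻¹`. -/

namespace SimpleGraph

variable {V : Type*} (G : SimpleGraph V) [G.LocallyFinite]

theorem laplaceFun_zero : G.laplaceFun 0 = 0 := by
  ext v
  simp [laplaceFun]

theorem laplaceFun_add (f g : V → ℂ) : G.laplaceFun (f + g) = G.laplaceFun f + G.laplaceFun g := by
  ext v
  simp only [laplaceFun, Pi.add_apply, ← Finset.sum_add_distrib]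
  exact Finset.sum_congr rfl fun _ _ => by ring

theorem laplaceFun_smul (c : ℂ) (f : V → ℂ) : G.laplaceFun (c • f) = c • G.laplaceFun f := by
  ext v
  simp only [laplaceFun, Pi.smul_apply, Finset.smul_sum, smul_sub]

theorem laplaceFun_sub (f g : V → ℂ) : G.laplaceFun (f - g) = G.laplaceFun f - G.laplaceFun g := by
  ext v
  simp only [laplaceFun, Pi.sub_apply, ← Finset.sum_sub_distrib]
  exact Finset.sum_congr rfl fun _ _ => by ring

theorem continuous_laplaceFun_apply (v : V) :
    Continuous fun f : GraphL2 V => G.laplaceFun (f : V → ℂ) v := by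
  unfold laplaceFun
  exact continuous_finsetSum _ fun u _ =>
    (graphL2_continuous_apply v).sub (graphL2_continuous_apply u)

/-- `-1` is not an eigenvalue of the Laplace operator. -/
theorem eq_zero_of_laplaceFun_eq_neg (f : GraphL2 V) (hf : G.laplaceFun (f : V → ℂ) = -f) :
    f = 0 := by
  by_contra hne
  obtain ⟨v₀, hv₀⟩ : ∃ v, f v ≠ 0 := by
    by_contra! h
    exact hne (lp.ext (funext h))
  obtain ⟨v, hv, hmax⟩ := exists_norm_apply_max f v₀ hv₀
  have h := congrFun hf v
  simp only [laplaceFun, Finset.sum_sub_distrib, Finset.sum_const, nsmul_eq_mul, Pi.neg_apply] at h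
  set d := (G.neighborFinset v).card
  -- Maximum principle: the right side has modulus at most `d * ‖f v‖`, the left side has modulus
  -- `(d + 1) * ‖f v‖`, and `f v ≠ 0`.
  have h' : ((d : ℂ) + 1) * f v = ∑ u ∈ G.neighborFinset v, f u := by linear_combination h
  have h1 : ‖∑ u ∈ G.neighborFinset v, f u‖ ≤ d * ‖f v‖ :=
    (norm_sum_le_of_le _ fun u _ => hmax u).trans (by simp [d])
  rw [← h', norm_mul] at h1
  have h2 : ‖(d : ℂ) + 1‖ = d + 1 := by
    have := Complex.norm_natCast (d + 1)
    push_cast at this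
    exact this
  rw [h2] at h1
  nlinarith [norm_pos_iff.2 hv]

/-- The Laplacian of the indicator function of a vertex. -/
noncomputable def laplaceDelta (v : V) : GraphL2 V :=
  ∑ u ∈ G.neighborFinset v, (vertexDelta v - vertexDelta u)

theorem inner_laplaceDelta (v : V) (f : GraphL2 V) :
    inner ℂ (G.laplaceDelta v) f = G.laplaceFun (f : V → ℂ) v := by
  simp only [laplaceDelta, laplaceFun, sum_inner, inner_sub_left, inner_vertexDelta]

theorem laplaceFun_vertexDelta (v : V) :
    G.laplaceFun (vertexDelta v : GraphL2 V) = G.laplaceDelta v := by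
  classical
  ext w
  rw [← inner_vertexDelta w (G.laplaceDelta v), ← inner_conj_symm, inner_laplaceDelta]
  simp only [laplaceFun, map_sum, map_sub, vertexDelta, lp.single_apply, Pi.single_apply]
  simp only [apply_ite (starRingEnd ℂ), map_one, map_zero, Finset.sum_sub_distrib, Finset.sum_const,
    nsmul_eq_mul, Finset.sum_ite_eq', mem_neighborFinset, G.adj_comm v w]
  by_cases h : w = v
  · subst h; simp
  · simp [h, Ne.symm h]

/-- The operator `1 + L` on finitely supported families. -/
noncomputable def oneAddLaplace : (V →₀ ℂ) →ₗ[ℂ] GraphL2 V :=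
  Finsupp.linearCombination ℂ fun v => vertexDelta v + G.laplaceDelta v

theorem oneAddLaplace_apply (c : V →₀ ℂ) :
    (G.oneAddLaplace c : V → ℂ) = ofFinsupp V c + G.laplaceFun (ofFinsupp V c) := by
  induction c using Finsupp.induction_linear with
  | zero =>
    rw [map_zero, map_zero, lp.coeFn_zero, laplaceFun_zero, add_zero]
  | add c d hc hd =>
    rw [map_add, map_add, lp.coeFn_add, lp.coeFn_add, laplaceFun_add, hc, hd]
    abel
  | single v a =>
    simp only [oneAddLaplace, ofFinsupp, Finsupp.linearCombination_single, lp.coeFn_smul,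
      laplaceFun_smul, laplaceFun_vertexDelta, lp.coeFn_add, smul_add]

theorem inner_oneAddLaplace (c : V →₀ ℂ) (f : GraphL2 V) :
    inner ℂ (G.oneAddLaplace c) f =
      ∑ v ∈ c.support, starRingEnd ℂ (c v) * (f v + G.laplaceFun (f : V → ℂ) v) := by
  simp only [oneAddLaplace, Finsupp.linearCombination_apply, Finsupp.sum, sum_inner, inner_smul_left,
    inner_vertexDelta, inner_add_left, inner_laplaceDelta]

theorem inner_oneAddLaplace_ofFinsupp (c d : V →₀ ℂ) :
    inner ℂ (G.oneAddLaplace c) (ofFinsupp V d) = inner ℂ (ofFinsupp V c) (G.oneAddLaplace d) := by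
  rw [inner_oneAddLaplace, inner_ofFinsupp, oneAddLaplace_apply]
  rfl

/-- The Laplace operator is nonnegative on finitely supported functions. -/
theorem re_sum_conj_mul_laplaceFun_nonneg (c : V →₀ ℂ) :
    0 ≤ (∑ v ∈ c.support, starRingEnd ℂ (c v) * G.laplaceFun c v).re := by
  classical
  set S := c.support
  -- This is `|c v - c u|² ≥ 0` rearranged; it avoids pairing the two orientations of an edge.
  have hterm : ∀ v u : V, (‖c v‖ ^ 2 - ‖c u‖ ^ 2) / 2 ≤
      (starRingEnd ℂ (c v) * (c v - c u)).re := by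
    intro v u
    simp only [← Complex.normSq_eq_norm_sq, Complex.normSq_apply, mul_re, conj_re, conj_im, sub_re,
      sub_im]
    nlinarith [sq_nonneg ((c v).re - (c u).re), sq_nonneg ((c v).im - (c u).im)]
  have hlow : ∑ v ∈ S, ∑ u ∈ G.neighborFinset v, (‖c v‖ ^ 2 - ‖c u‖ ^ 2) / 2 ≤
      (∑ v ∈ S, starRingEnd ℂ (c v) * G.laplaceFun c v).re := by
    rw [re_sum]
    refine Finset.sum_le_sum fun v _ => ?_
    rw [laplaceFun, Finset.mul_sum, re_sum]
    exact Finset.sum_le_sum fun u _ => hterm v u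
  refine le_trans ?_ hlow
  simp only [← Finset.sum_div, Finset.sum_sub_distrib]
  -- Neighbours outside the support contribute nothing on the left. By symmetry of adjacency, each
  -- `‖c u‖²` is then counted at most degree-of-`u` times.
  suffices h : ∑ v ∈ S, ∑ u ∈ G.neighborFinset v, ‖c u‖ ^ 2 ≤
      ∑ v ∈ S, ∑ _u ∈ G.neighborFinset v, ‖c v‖ ^ 2 by linarith
  calc ∑ v ∈ S, ∑ u ∈ G.neighborFinset v, ‖c u‖ ^ 2
      = ∑ v ∈ S, ∑ u ∈ S, if G.Adj v u then ‖c u‖ ^ 2 else 0 := by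
        refine Finset.sum_congr rfl fun v _ => ?_
        rw [← Finset.sum_filter]
        refine (Finset.sum_subset (fun u => by simp) fun u hu hu' => ?_).symm
        have : c u = 0 := by
          by_contra h
          exact hu' (by simpa [S, h] using hu)
        simp [this]
    _ = ∑ u ∈ S, ∑ v ∈ S, if G.Adj v u then ‖c u‖ ^ 2 else 0 := Finset.sum_comm
    _ ≤ ∑ v ∈ S, ∑ _u ∈ G.neighborFinset v, ‖c v‖ ^ 2 := by
        refine Finset.sum_le_sum fun v _ => ?_
        rw [← Finset.sum_filter]
        refine Finset.sum_le_sum_of_subset_of_nonneg (fun u => ?_) fun _ _ _ => by positivity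
        simp only [Finset.mem_filter, mem_neighborFinset, and_imp]
        exact fun _ h => h.symm

/-- Coercivity of `1 + L`; with Cauchy-Schwarz it makes the inverse a contraction. -/
theorem norm_sq_ofFinsupp_le (c : V →₀ ℂ) :
    ‖ofFinsupp V c‖ ^ 2 ≤ (inner ℂ (ofFinsupp V c) (G.oneAddLaplace c)).re := by
  have hc : ((ofFinsupp V c : GraphL2 V) : V → ℂ) = c := funext (ofFinsupp_apply c)
  have h := G.re_sum_conj_mul_laplaceFun_nonneg c
  have h2 : (inner ℂ (ofFinsupp V c) (ofFinsupp V c) : ℂ).re = ‖ofFinsupp V c‖ ^ 2 := by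
    rw [inner_self_eq_norm_sq_to_K]
    norm_cast
  rw [← h2, inner_ofFinsupp, inner_ofFinsupp, oneAddLaplace_apply, hc]
  simp only [Pi.add_apply, mul_add, Finset.sum_add_distrib, add_re]
  linarith

theorem norm_ofFinsupp_le (c : V →₀ ℂ) : ‖ofFinsupp V c‖ ≤ 1 * ‖G.oneAddLaplace c‖ := by
  have h := G.norm_sq_ofFinsupp_le c
  have h2 := (Complex.re_le_norm _).trans (norm_inner_le_norm (𝕜 := ℂ) (ofFinsupp V c) (G.oneAddLaplace c))
  rcases (norm_nonneg (ofFinsupp V c)).eq_or_lt with h0 | h0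
  · rw [← h0]; positivity
  · nlinarith

/-- Orthogonality to `(1 + L)δ_v` says `f v + (L f) v = 0`. Holding at every vertex, it makes `f` an
eigenfunction for `-1`, hence zero. -/
theorem denseRange_oneAddLaplace : DenseRange G.oneAddLaplace := by
  have : Dense ((LinearMap.range G.oneAddLaplace : Submodule ℂ (GraphL2 V)) : Set (GraphL2 V)) := by
    rw [Submodule.dense_iff_topologicalClosure_eq_top, Submodule.topologicalClosure_eq_top_iff,
      Submodule.eq_bot_iff]
    intro f hf
    refine G.eq_zero_of_laplaceFun_eq_neg f (funext fun v => ?_)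
    have h := (Submodule.mem_orthogonal _ _).1 hf _ ⟨Finsupp.single v 1, rfl⟩
    rw [oneAddLaplace, Finsupp.linearCombination_single, one_smul, inner_add_left,
      inner_vertexDelta, inner_laplaceDelta] at h
    simpa using eq_neg_of_add_eq_zero_right h
  exact this

/-- The resolvent `(1 + L)⁻¹`. -/
noncomputable def resolvent : GraphL2 V →L[ℂ] GraphL2 V :=
  (ofFinsupp V).extendOfNorm G.oneAddLaplace

theorem resolvent_oneAddLaplace (c : V →₀ ℂ) : G.resolvent (G.oneAddLaplace c) = ofFinsupp V c :=
  LinearMap.extendOfNorm_eq G.denseRange_oneAddLaplace ⟨1, G.norm_ofFinsupp_le⟩ c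

theorem norm_resolvent_le : ‖G.resolvent‖ ≤ 1 :=
  LinearMap.opNorm_extendOfNorm_le G.denseRange_oneAddLaplace zero_le_one G.norm_ofFinsupp_le

/-- At a fixed vertex `L` involves finitely many coordinates, so it is continuous there and the
identity extends from the dense range, even for unbounded `L`. -/
theorem laplaceFun_resolvent (g : GraphL2 V) :
    G.laplaceFun (G.resolvent g) = (g - G.resolvent g : GraphL2 V) := by
  ext v
  refine G.denseRange_oneAddLaplace.induction_on
    (p := fun g => G.laplaceFun (G.resolvent g) v = (g - G.resolvent g : GraphL2 V) v) g
    (isClosed_eq ((G.continuous_laplaceFun_apply v).comp G.resolvent.continuous)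
      ((graphL2_continuous_apply v).comp (by fun_prop))) fun c => ?_
  rw [lp.coeFn_sub, resolvent_oneAddLaplace, oneAddLaplace_apply]
  simp

theorem resolvent_isSelfAdjoint : IsSelfAdjoint G.resolvent := by
  rw [ContinuousLinearMap.isSelfAdjoint_iff_isSymmetric]
  intro x y
  refine G.denseRange_oneAddLaplace.induction_on₂
    (p := fun x y => inner ℂ (G.resolvent x) y = inner ℂ x (G.resolvent y))
    (isClosed_eq (by fun_prop) (by fun_prop)) (fun c d => ?_) x y
  rw [resolvent_oneAddLaplace, resolvent_oneAddLaplace, inner_oneAddLaplace_ofFinsupp]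

theorem resolvent_nonneg : 0 ≤ G.resolvent := by
  rw [ContinuousLinearMap.nonneg_iff_isPositive, ContinuousLinearMap.isPositive_def]
  refine ⟨ContinuousLinearMap.isSelfAdjoint_iff_isSymmetric.1 G.resolvent_isSelfAdjoint, fun x => ?_⟩
  refine G.denseRange_oneAddLaplace.induction_on (p := fun x => 0 ≤ G.resolvent.reApplyInnerSelf x) x
    (isClosed_le continuous_const G.resolvent.reApplyInnerSelf_continuous) fun c => ?_
  rw [ContinuousLinearMap.reApplyInnerSelf_apply, resolvent_oneAddLaplace]
  exact (sq_nonneg _).trans (G.norm_sq_ofFinsupp_le c)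

/-- The difference of the two sides solves `Lu = -u`. Thus the range of the resolvent exhausts the
maximal domain. -/
theorem eq_resolvent_of_laplaceFun_eq {f g : GraphL2 V} (h : (g : V → ℂ) = G.laplaceFun (f : V → ℂ)) :
    f = G.resolvent (f + g) := by
  refine sub_eq_zero.1 (G.eq_zero_of_laplaceFun_eq_neg _ ?_)
  rw [lp.coeFn_sub, laplaceFun_sub, laplaceFun_resolvent, ← h]
  simp only [lp.coeFn_sub, lp.coeFn_add]
  abel

theorem resolvent_injective : Function.Injective G.resolvent := by
  refine (injective_iff_map_eq_zero _).2 fun g hg => ?_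
  have h := G.laplaceFun_resolvent g
  rw [hg, sub_zero] at h
  exact lp.ext (h.symm.trans G.laplaceFun_zero)

end SimpleGraph

/-! ### The unitary group of a self-adjoint operator with a given resolvent -/

section

open Filter Topology

variable {H : Type*} [NormedAddCommGroup H] [InnerProductSpace ℂ H]

/-- Strong convergence of uniformly bounded operators may be checked on a dense set. -/
theorem tendsto_apply_of_denseRange {ι α : Type*} {l : Filter ι} {A : ι → H →L[ℂ] H} {B : H →L[ℂ] H}
    {C : ℝ} (hA : ∀ i, ‖A i‖ ≤ C) {e : α → H} (he : DenseRange e)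
    (h : ∀ g, Tendsto (fun i => A i (e g)) l (𝓝 (B (e g)))) (f : H) :
    Tendsto (fun i => A i f) l (𝓝 (B f)) := by
  rw [Metric.tendsto_nhds]
  intro ε hε
  set K := |C| + ‖B‖ + 1
  have hK : 0 < K := by positivity
  obtain ⟨g, hg⟩ := he.exists_dist_lt f (ε := ε / (2 * K)) (by positivity)
  filter_upwards [Metric.tendsto_nhds.1 (h g) (ε / 2) (by positivity)] with i hi
  rw [dist_eq_norm] at hi hg ⊢
  have h1 : A i f - B f = (A i (e g) - B (e g)) + (A i (f - e g) - B (f - e g)) := by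
    simp only [map_sub]; abel
  have h2 : ‖A i (f - e g)‖ ≤ |C| * ‖f - e g‖ :=
    ((A i).le_opNorm _).trans (by gcongr; exact (hA i).trans (le_abs_self C))
  have h3 := B.le_opNorm (f - e g)
  have h4 : K * ‖f - e g‖ < ε / 2 := by
    calc K * ‖f - e g‖ < K * (ε / (2 * K)) := by gcongr
      _ = ε / 2 := by field_simp
  have h5 : (|C| + ‖B‖) * ‖f - e g‖ ≤ K * ‖f - e g‖ := by
    gcongr; simp [K]
  rw [h1]
  calc _ ≤ ‖A i (e g) - B (e g)‖ + (‖A i (f - e g)‖ + ‖B (f - e g)‖) :=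
        (norm_add_le _ _).trans (by gcongr; exact norm_sub_le _ _)
    _ < ε := by linarith

/-! ### Continuous functional calculus of a positive contraction. -/

variable [CompleteSpace H] {R : H →L[ℂ] H}

/-- The continuous functional calculus of `R` for functions on the real line. -/
noncomputable def contCalc (R : H →L[ℂ] H) (φ : ℝ → ℂ) : H →L[ℂ] H := cfc (fun z : ℂ => φ z.re) R

section ContCalc

variable {φ ψ : ℝ → ℂ}

theorem contCalc_mul (hφ : Continuous φ) (hψ : Continuous ψ) :
    contCalc R (fun r => φ r * ψ r) = contCalc R φ * contCalc R ψ :=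
  cfc_mul _ _ R (hφ.comp continuous_re).continuousOn (hψ.comp continuous_re).continuousOn

theorem contCalc_sub (hφ : Continuous φ) (hψ : Continuous ψ) :
    contCalc R (fun r => φ r - ψ r) = contCalc R φ - contCalc R ψ :=
  cfc_sub _ _ R (hφ.comp continuous_re).continuousOn (hψ.comp continuous_re).continuousOn

theorem contCalc_const_mul (c : ℂ) (hφ : Continuous φ) :
    contCalc R (fun r => c * φ r) = c • contCalc R φ :=
  cfc_const_mul c _ R (hφ.comp continuous_re).continuousOn

theorem contCalc_star : contCalc R (fun r => star (φ r)) = star (contCalc R φ) := cfc_star _ R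

theorem contCalc_const (hR : 0 ≤ R) (c : ℂ) : contCalc R (fun _ => c) = c • 1 := by
  have : IsStarNormal R := (IsSelfAdjoint.of_nonneg hR).isStarNormal
  rw [contCalc, cfc_const c R, Algebra.algebraMap_eq_smul_one]

theorem mem_spectrum_re (hR : 0 ≤ R) (hR1 : ‖R‖ ≤ 1) {z : ℂ} (hz : z ∈ spectrum ℂ R) :
    z = z.re ∧ z.re ∈ Set.Icc (0 : ℝ) 1 := by
  have h1 := (IsSelfAdjoint.of_nonneg hR).mem_spectrum_eq_re hz
  refine ⟨h1, ?_, ?_⟩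
  · rw [h1] at hz
    exact spectrum_nonneg_of_nonneg hR ((spectrum.algebraMap_mem_iff ℂ (R := ℝ) (a := R)).1 hz)
  · cases subsingleton_or_nontrivial H
    · simp [spectrum.of_subsingleton] at hz
    exact (re_le_norm z).trans ((spectrum.norm_le_norm_of_mem hz).trans hR1)

theorem contCalc_ofReal (hR : 0 ≤ R) : contCalc R (fun r => (r : ℂ)) = R := by
  have : IsStarNormal R := (IsSelfAdjoint.of_nonneg hR).isStarNormal
  refine (cfc_congr fun z hz => ?_).trans (cfc_id ℂ R)
  exact ((IsSelfAdjoint.of_nonneg hR).mem_spectrum_eq_re hz).symm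

/-- The measure representing the functional calculus of `R` at the vector `f`. -/
theorem exists_measure_contCalc (hR : 0 ≤ R) (hR1 : ‖R‖ ≤ 1) (f : H) :
    ∃ ν : Measure ℝ, IsFiniteMeasure ν ∧ ν (Set.Icc 0 1)ᶜ = 0 ∧
      ∀ φ : ℝ → ℂ, Continuous φ → inner ℂ f (contCalc R φ f) = ∫ r, φ r ∂ν := by
  have hn : IsStarNormal R := (IsSelfAdjoint.of_nonneg hR).isStarNormal
  -- Riesz-Markov is applied to `φ ↦ Re ⟨f, φ(R) f⟩` on real functions on the spectrum; positivity
  -- comes from `φ = (√φ)²`. The real part loses nothing, since `φ(R)` is self-adjoint (`hsa`).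
  let J : CompactlySupportedContinuousMap (spectrum ℂ R) ℝ → C(spectrum ℂ R, ℂ) := fun φ =>
    ⟨fun x => (φ x : ℂ), continuous_ofReal.comp φ.continuous⟩
  let Λ₀ : CompactlySupportedContinuousMap (spectrum ℂ R) ℝ →ₗ[ℝ] ℝ :=
    { toFun := fun φ => (inner ℂ f (cfcHom hn (J φ) f)).re
      map_add' := fun φ ψ => by
        have : J (φ + ψ) = J φ + J ψ := by ext x; simp [J]
        simp [this]
      map_smul' := fun c φ => by
        have : J (c • φ) = (c : ℂ) • J φ := by ext x; simp [J]
        simp [this] }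
  let Λ := PositiveLinearMap.mk₀ Λ₀ (fun φ hφ => by
    change 0 ≤ (inner ℂ f (cfcHom hn (J φ) f)).re
    let S : C(spectrum ℂ R, ℂ) := ⟨fun x => ((√(φ x) : ℝ) : ℂ),
      continuous_ofReal.comp (Real.continuous_sqrt.comp φ.continuous)⟩
    have hS : J φ = star S * S := by
      ext x
      have : 0 ≤ φ x := hφ x
      simp [J, S, ← ofReal_mul, Real.mul_self_sqrt this]
    rw [hS, map_mul, map_star, mul_apply_eq_comp,
      ContinuousLinearMap.star_eq_adjoint, ContinuousLinearMap.adjoint_inner_right]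
    exact inner_self_nonneg (𝕜 := ℂ))
  have hcs : CompactSpace (spectrum ℂ R) := isCompact_iff_compactSpace.1 (spectrum.isCompact R)
  let ν₀ := RealRMK.rieszMeasure Λ
  have hν₀ : ∀ φ : C(spectrum ℂ R, ℝ),
      ∫ x, φ x ∂ν₀ = (inner ℂ f (cfcHom hn ⟨fun x => (φ x : ℂ), by fun_prop⟩ f)).re := fun φ =>
    RealRMK.integral_rieszMeasure Λ (CompactlySupportedContinuousMap.continuousMapEquiv φ)
  have hsa : ∀ φ : C(spectrum ℂ R, ℝ),
      (inner ℂ f (cfcHom hn ⟨fun x => (φ x : ℂ), by fun_prop⟩ f)).im = 0 := fun φ => by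
    set g : C(spectrum ℂ R, ℂ) := ⟨fun x => (φ x : ℂ), by fun_prop⟩ with hg
    have h1 : star (cfcHom hn g) = cfcHom hn g := by
      rw [← map_star]
      congr 1
      ext x
      simp [hg]
    have h2 : starRingEnd ℂ (inner ℂ f (cfcHom hn g f)) = inner ℂ f (cfcHom hn g f) := by
      rw [inner_conj_symm]
      nth_rewrite 1 [← h1]
      rw [ContinuousLinearMap.star_eq_adjoint, ContinuousLinearMap.adjoint_inner_left]
    exact conj_eq_iff_im.1 h2
  have hfin : IsFiniteMeasure ν₀ := ⟨isCompact_univ.measure_lt_top⟩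
  have hmeas : Measurable fun x : spectrum ℂ R => (x : ℂ).re := by fun_prop
  refine ⟨ν₀.map fun x : spectrum ℂ R => (x : ℂ).re, inferInstance, ?_, fun φ hφ => ?_⟩
  · rw [Measure.map_apply hmeas measurableSet_Icc.compl]
    convert measure_empty (μ := ν₀)
    ext x
    simpa using (mem_spectrum_re hR hR1 x.2).2
  · rw [integral_map hmeas.aemeasurable hφ.aestronglyMeasurable]
    let re' : C(spectrum ℂ R, ℝ) := ⟨fun x => (φ (x : ℂ).re).re, by fun_prop⟩
    let im' : C(spectrum ℂ R, ℝ) := ⟨fun x => (φ (x : ℂ).re).im, by fun_prop⟩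
    have hint : Integrable (fun x : spectrum ℂ R => φ (x : ℂ).re) ν₀ :=
      (show Continuous fun x : spectrum ℂ R => φ (x : ℂ).re by fun_prop).integrable_of_hasCompactSupport
        (HasCompactSupport.of_compactSpace _)
    have hre : (∫ x : spectrum ℂ R, φ (x : ℂ).re ∂ν₀).re = ∫ x, re' x ∂ν₀ :=
      (integral_re hint).symm
    have him : (∫ x : spectrum ℂ R, φ (x : ℂ).re ∂ν₀).im = ∫ x, im' x ∂ν₀ :=
      (integral_im hint).symm
    rw [← re_add_im (∫ x : spectrum ℂ R, φ (x : ℂ).re ∂ν₀), hre, him, hν₀, hν₀]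
    have hc : contCalc R φ = cfcHom hn ⟨fun x => (re' x : ℂ), by fun_prop⟩ +
        I • cfcHom hn ⟨fun x => (im' x : ℂ), by fun_prop⟩ := by
      rw [contCalc, cfc_apply (fun z : ℂ => φ z.re) R hn (hφ.comp continuous_re).continuousOn, ← map_smul, ← map_add]
      congr 1
      ext x
      simp [re', im', mul_comm I]
    rw [hc, add_apply, smul_apply, inner_add_right,
      inner_smul_right]
    have h1 := hsa re'
    have h2 := hsa im'
    apply Complex.ext <;> simp [h1, h2]

/-- Because `‖χ(R) f‖² = ∫ |χ|² dν` with `ν` carried by `[0, 1]`, pointwise comparison of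
multipliers passes to the operators. -/
theorem norm_contCalc_le_norm (hR : 0 ≤ R) (hR1 : ‖R‖ ≤ 1) (hφ : Continuous φ) (hψ : Continuous ψ)
    (h : ∀ r ∈ Set.Icc (0 : ℝ) 1, ‖φ r‖ ≤ ‖ψ r‖) (f : H) :
    ‖contCalc R φ f‖ ≤ ‖contCalc R ψ f‖ := by
  obtain ⟨ν, hfin, hν, hint⟩ := exists_measure_contCalc hR hR1 f
  have key : ∀ χ : ℝ → ℂ, Continuous χ →
      ‖contCalc R χ f‖ ^ 2 = ∫ r, ‖χ r‖ ^ 2 ∂ν := fun χ hχ => by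
    have h1 := hint (fun r => star (χ r) * χ r) (by fun_prop)
    rw [contCalc_mul (by fun_prop) hχ, contCalc_star, mul_apply_eq_comp,
      ContinuousLinearMap.star_eq_adjoint, ContinuousLinearMap.adjoint_inner_right,
      inner_self_eq_norm_sq_to_K] at h1
    have h2 : ∀ r, star (χ r) * χ r = ((‖χ r‖ ^ 2 : ℝ) : ℂ) := fun r => by
      rw [mul_comm, star_def, mul_conj, normSq_eq_norm_sq]
    simp_rw [h2] at h1
    exact_mod_cast h1.trans integral_ofReal
  have hae : ∀ᵐ r ∂ν, r ∈ Set.Icc (0 : ℝ) 1 := hν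
  have hi : ∀ χ : ℝ → ℂ, Continuous χ → Integrable (fun r => ‖χ r‖ ^ 2) ν := fun χ hχ => by
    obtain ⟨C, hC⟩ := isCompact_Icc.exists_bound_of_continuousOn (s := Set.Icc (0 : ℝ) 1)
      (f := fun r => ‖χ r‖ ^ 2) (by fun_prop)
    exact Integrable.of_bound (by fun_prop) C (hae.mono fun r hr => hC r hr)
  refine le_of_sq_le_sq ?_ (norm_nonneg _)
  rw [key φ hφ, key ψ hψ]
  refine integral_mono_ae (hi φ hφ) (hi ψ hψ) (hae.mono fun r hr => ?_)
  have := h r hr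
  simp only
  gcongr

theorem norm_contCalc_le (hR : 0 ≤ R) (hR1 : ‖R‖ ≤ 1) (hφ : Continuous φ) {C : ℝ} (hC : 0 ≤ C)
    (h : ∀ r ∈ Set.Icc (0 : ℝ) 1, ‖φ r‖ ≤ C) : ‖contCalc R φ‖ ≤ C := by
  refine ContinuousLinearMap.opNorm_le_bound _ hC fun f => ?_
  refine (norm_contCalc_le_norm hR hR1 hφ (continuous_const (y := (C : ℂ)))
    (fun r hr => (h r hr).trans (by simp [abs_of_nonneg hC])) f).trans ?_
  rw [contCalc_const hR]
  simp [norm_smul, abs_of_nonneg hC]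

end ContCalc

/-! ### The multiplier of `e^{itL} R` and its estimates. -/

/-- The function `r ↦ r e^{it(1/r - 1)}`. If `R = (1 + L)⁻¹` it represents `e^{itL} R`. -/
noncomputable def phase (t r : ℝ) : ℂ := exp (I * t * ((r⁻¹ - 1 : ℝ) : ℂ)) * r

theorem norm_exp_I_mul_mul (t x : ℝ) : ‖exp (I * t * x)‖ = 1 := by
  rw [mul_assoc, ← ofReal_mul, norm_exp_I_mul_ofReal]

theorem norm_phase (t r : ℝ) : ‖phase t r‖ = |r| := by
  rw [phase, norm_mul, norm_exp_I_mul_mul, one_mul, norm_real, Real.norm_eq_abs]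

theorem phase_zero (r : ℝ) : phase 0 r = r := by simp [phase]

theorem phase_mul_phase (s t r : ℝ) : phase s r * phase t r = phase (s + t) r * r := by
  simp only [phase]
  rw [ofReal_add, mul_add, add_mul, Complex.exp_add]
  ring

/-- The factor `r` damps the oscillation at `0`; the bare exponential has no continuous extension
there when `t ≠ 0`. -/
theorem continuous_phase (t : ℝ) : Continuous (phase t) := by
  rw [continuous_iff_continuousAt]
  intro r
  rcases eq_or_ne r 0 with rfl | hr
  · have h0 : phase t 0 = 0 := by simp [phase]
    rw [ContinuousAt, h0]
    refine squeeze_zero_norm (a := fun r => |r|) (fun r => (norm_phase t r).le) ?_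
    exact Continuous.tendsto' (by fun_prop) 0 0 (by simp)
  · unfold phase
    have : ContinuousAt (fun r : ℝ => r⁻¹) r := continuousAt_inv₀ hr
    fun_prop

/-- The scalar form of the boundedness of `LR = 1 - R`. -/
theorem mul_inv_sub_one {r : ℝ} (hr : r ∈ Set.Icc (0 : ℝ) 1) :
    |r⁻¹ - 1| * |r| ≤ 1 := by
  rcases hr.1.eq_or_lt with h | h
  · simp [← h]
  · rw [← abs_mul, sub_mul, inv_mul_cancel₀ h.ne', one_mul, abs_of_nonneg (by linarith [hr.2])]
    linarith

theorem norm_phase_sub_le (s t : ℝ) {r : ℝ} (hr : r ∈ Set.Icc (0 : ℝ) 1) :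
    ‖phase t r - phase s r‖ ≤ |t - s| := by
  have h : phase t r - phase s r =
      exp (I * s * ((r⁻¹ - 1 : ℝ) : ℂ)) * (exp (I * (((t - s) * (r⁻¹ - 1) : ℝ) : ℂ)) - 1) * r := by
    rw [mul_sub, ← Complex.exp_add, phase, phase, mul_one, sub_mul]
    push_cast
    ring_nf
  rw [h, norm_mul, norm_mul, norm_exp_I_mul_mul, one_mul, norm_real, Real.norm_eq_abs]
  calc _ ≤ ‖(t - s) * (r⁻¹ - 1)‖ * |r| := by
        gcongr; exact Real.norm_exp_I_mul_ofReal_sub_one_le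
    _ = |t - s| * (|r⁻¹ - 1| * |r|) := by rw [norm_mul, Real.norm_eq_abs, Real.norm_eq_abs]; ring
    _ ≤ |t - s| := mul_le_of_le_one_right (abs_nonneg _) (mul_inv_sub_one hr)

theorem norm_exp_sub_one_sub_le (x : ℝ) : ‖exp (I * x) - 1 - I * x‖ ≤ 2 * x ^ 2 := by
  rcases le_total |x| 1 with h | h
  · have := norm_exp_sub_one_sub_id_le (x := I * x) (by simpa using h)
    simp only [norm_mul, norm_I, norm_real, Real.norm_eq_abs, one_mul, sq_abs] at this
    nlinarith [sq_nonneg x]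
  · have h1 : ‖exp (I * x) - 1‖ ≤ ‖x‖ := Real.norm_exp_I_mul_ofReal_sub_one_le
    have h2 := norm_sub_le (exp (I * x) - 1) (I * x)
    simp only [norm_mul, norm_I, norm_real, Real.norm_eq_abs, one_mul] at h1 h2
    nlinarith [sq_abs x]

/-- The second-order Taylor remainder is of size `(tλ)²` with `λ = 1/r - 1`. Absorbing `λ²` takes
two factors `r`, whence the extra multiplication by `r`. -/
theorem norm_phase_sub_sub_mul_le (t : ℝ) {r : ℝ} (hr : r ∈ Set.Icc (0 : ℝ) 1) :
    ‖(phase t r - r - I * t * (1 - r)) * r‖ ≤ 2 * t ^ 2 := by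
  rcases hr.1.eq_or_lt with h0 | h0
  · simp [← h0]; positivity
  have hr' : (r : ℂ) ≠ 0 := by exact_mod_cast h0.ne'
  have h : (phase t r - r - I * t * (1 - r)) * r =
      (exp (I * ((t * (r⁻¹ - 1) : ℝ) : ℂ)) - 1 - I * ((t * (r⁻¹ - 1) : ℝ) : ℂ)) * r * r := by
    simp only [phase]
    push_cast
    field_simp
  rw [h, norm_mul, norm_mul, norm_real, Real.norm_eq_abs]
  calc _ ≤ 2 * (t * (r⁻¹ - 1)) ^ 2 * |r| * |r| := by
        gcongr; exact norm_exp_sub_one_sub_le _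
    _ = 2 * t ^ 2 * (|r⁻¹ - 1| * |r|) ^ 2 := by
        rw [mul_pow |_|, sq_abs, sq_abs, mul_assoc, abs_mul_abs_self]; ring
    _ ≤ 2 * t ^ 2 * 1 := by
        gcongr; exact pow_le_one₀ (by positivity) (mul_inv_sub_one hr)
    _ = 2 * t ^ 2 := mul_one _

/-! ### The unitary group built from the resolvent. -/

section Group

theorem denseRange_of_injective (hR : IsSelfAdjoint R) (hinj : Function.Injective R) :
    DenseRange R := by
  have : Dense ((LinearMap.range (R : H →ₗ[ℂ] H) : Submodule ℂ H) : Set H) := by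
    rw [Submodule.dense_iff_topologicalClosure_eq_top, Submodule.topologicalClosure_eq_top_iff,
      Submodule.eq_bot_iff]
    intro f hf
    refine hinj ((inner_self_eq_zero (𝕜 := ℂ)).1 ?_ |>.trans (map_zero R).symm)
    rw [ContinuousLinearMap.isSelfAdjoint_iff_isSymmetric] at hR
    exact (hR f (R f)).trans (inner_eq_zero_symm.1 ((Submodule.mem_orthogonal _ _).1 hf _ ⟨R f, rfl⟩))
  exact this

theorem norm_contCalc_phase_apply (hR : 0 ≤ R) (hR1 : ‖R‖ ≤ 1) (t : ℝ) (g : H) :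
    ‖contCalc R (phase t) g‖ = ‖R g‖ := by
  rw [show ‖R g‖ = ‖contCalc R (fun r : ℝ => (r : ℂ)) g‖ by rw [contCalc_ofReal hR]]
  refine le_antisymm ?_ ?_ <;>
    exact norm_contCalc_le_norm hR hR1 (by first | exact continuous_phase t | fun_prop)
      (by first | exact continuous_phase t | fun_prop) (fun r _ => by simp [norm_phase]) g

/-- The unitary group `e^{itL}`, where `R = (1 + L)⁻¹`. -/
noncomputable def resolventGroup (R : H →L[ℂ] H) (t : ℝ) : H →L[ℂ] H :=
  (contCalc R (phase t) : H →ₗ[ℂ] H).extendOfNorm (R : H →ₗ[ℂ] H)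

variable (hR : 0 ≤ R) (hR1 : ‖R‖ ≤ 1) (hd : DenseRange R)
include hR hR1 hd

theorem resolventGroup_apply (t : ℝ) (g : H) :
    resolventGroup R t (R g) = contCalc R (phase t) g :=
  LinearMap.extendOfNorm_eq (f := (contCalc R (phase t) : H →ₗ[ℂ] H)) (e := (R : H →ₗ[ℂ] H)) hd
    ⟨1, fun x => by rw [one_mul]; exact (norm_contCalc_phase_apply hR hR1 t x).le⟩ g

theorem norm_resolventGroup_apply (t : ℝ) (f : H) : ‖resolventGroup R t f‖ = ‖f‖ := by
  refine hd.induction_on (p := fun f => ‖resolventGroup R t f‖ = ‖f‖) f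
    (isClosed_eq (by fun_prop) (by fun_prop)) fun g => ?_
  rw [resolventGroup_apply hR hR1 hd, norm_contCalc_phase_apply hR hR1]

theorem resolventGroup_zero : resolventGroup R 0 = 1 := by
  ext f
  refine hd.induction_on (p := fun f => resolventGroup R 0 f = f) f
    (isClosed_eq (by fun_prop) (by fun_prop)) fun g => ?_
  rw [resolventGroup_apply hR hR1 hd, show phase 0 = fun r : ℝ => (r : ℂ) from funext phase_zero,
    contCalc_ofReal hR]

theorem resolventGroup_add (s t : ℝ) :
    resolventGroup R (s + t) = resolventGroup R s * resolventGroup R t := by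
  ext f
  refine hd.induction_on (p := fun f => resolventGroup R (s + t) f =
    (resolventGroup R s * resolventGroup R t) f) f (isClosed_eq (by fun_prop) (by fun_prop)) fun g => ?_
  -- A product of two phases carries `r²`, so the group law is checked on the range of `R²`, which
  -- takes a second density argument.
  refine hd.induction_on (p := fun g => resolventGroup R (s + t) (R g) =
    (resolventGroup R s * resolventGroup R t) (R g)) g
    (isClosed_eq (by fun_prop) (by fun_prop)) fun g => ?_
  have hc : Continuous fun r : ℝ => (r : ℂ) := continuous_ofReal
  have hcomm : contCalc R (phase t) (R g) = R (contCalc R (phase t) g) := by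
    have h : contCalc R (phase t) * R = R * contCalc R (phase t) := by
      nth_rewrite 2 3 [← contCalc_ofReal hR]
      rw [← contCalc_mul (continuous_phase t) hc, ← contCalc_mul hc (continuous_phase t)]
      simp_rw [mul_comm]
    exact congrArg (fun A : H →L[ℂ] H => A g) h
  have hmul : contCalc R (phase (s + t)) * R = contCalc R (phase s) * contCalc R (phase t) := by
    nth_rewrite 2 [← contCalc_ofReal hR]
    rw [← contCalc_mul (continuous_phase _) hc,
      ← contCalc_mul (continuous_phase s) (continuous_phase t)]
    simp_rw [phase_mul_phase]
  rw [mul_apply_eq_comp, resolventGroup_apply hR hR1 hd, resolventGroup_apply hR hR1 hd, hcomm,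
    resolventGroup_apply hR hR1 hd]
  exact congrArg (fun A : H →L[ℂ] H => A g) hmul

theorem norm_resolventGroup_le (t : ℝ) : ‖resolventGroup R t‖ ≤ 1 :=
  ContinuousLinearMap.opNorm_le_bound _ zero_le_one fun f => by
    rw [one_mul, norm_resolventGroup_apply hR hR1 hd]

omit hd in
theorem norm_contCalc_phase_sub_le (s t : ℝ) :
    ‖contCalc R (phase t) - contCalc R (phase s)‖ ≤ |t - s| := by
  rw [← contCalc_sub (continuous_phase t) (continuous_phase s)]
  exact norm_contCalc_le hR hR1 ((continuous_phase t).sub (continuous_phase s)) (abs_nonneg _)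
    fun r hr => norm_phase_sub_le s t hr

theorem continuous_resolventGroup (f : H) : Continuous fun t => resolventGroup R t f := by
  rw [continuous_iff_continuousAt]
  intro t
  refine tendsto_apply_of_denseRange (norm_resolventGroup_le hR hR1 hd) hd (fun g => ?_) f
  simp_rw [resolventGroup_apply hR hR1 hd]
  have hl : LipschitzWith 1 fun t => contCalc R (phase t) :=
    LipschitzWith.of_dist_le_mul fun t s => by
      rw [NNReal.coe_one, one_mul, dist_eq_norm, Real.dist_eq]
      exact norm_contCalc_phase_sub_le hR hR1 s t
  exact (hl.continuous.clm_apply continuous_const).tendsto t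

theorem hasDerivAt_resolventGroup (g : H) :
    HasDerivAt (fun t => resolventGroup R t (R g)) (I • (g - R g)) 0 := by
  simp_rw [resolventGroup_apply hR hR1 hd]
  rw [hasDerivAt_iff_tendsto_slope]
  have hc : Continuous fun r : ℝ => (r : ℂ) := continuous_ofReal
  have h0 : contCalc R (phase 0) = R := by
    rw [show phase 0 = fun r : ℝ => (r : ℂ) from funext phase_zero, contCalc_ofReal hR]
  -- The Lipschitz bound makes the difference quotients uniformly bounded on the range of `R`. It
  -- then suffices to find their limit on the range of `R²`, where the Taylor estimate applies.
  have key := tendsto_apply_of_denseRange (l := 𝓝[≠] (0 : ℝ))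
    (A := fun t : ℝ => ((t : ℂ)⁻¹) • (contCalc R (phase t) - contCalc R (phase 0)))
    (B := I • (1 - R)) (C := 1) (fun t => ?_) hd (fun g => ?_) g
  · refine (key.congr fun t => ?_)
    rw [slope_def_module, sub_zero, smul_apply, sub_apply, ← ofReal_inv]
    exact RCLike.real_smul_eq_coe_smul (K := ℂ) _ _ |>.symm
  · rw [norm_smul, norm_inv, norm_real, Real.norm_eq_abs]
    have := norm_contCalc_phase_sub_le hR hR1 0 t
    rw [sub_zero] at this
    exact (mul_le_mul_of_nonneg_left this (by positivity)).trans (inv_mul_le_one)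
  · rw [tendsto_iff_norm_sub_tendsto_zero]
    have hop : ∀ t : ℝ, contCalc R (fun r => (phase t r - r - I * t * (1 - r)) * r) =
        (contCalc R (phase t) - contCalc R (phase 0) - (I * t) • (1 - R)) * R := fun t => by
      rw [contCalc_mul (by have := continuous_phase t; fun_prop) hc,
        contCalc_sub (by have := continuous_phase t; fun_prop) (by fun_prop),
        contCalc_sub (continuous_phase t) hc, contCalc_const_mul _ (by fun_prop),
        contCalc_sub (by fun_prop) hc, contCalc_ofReal hR, contCalc_const hR, one_smul, h0]
    have hb : ∀ t : ℝ, t ≠ 0 → ‖((t : ℂ)⁻¹ • (contCalc R (phase t) - contCalc R (phase 0))) (R g) -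
        (I • (1 - R)) (R g)‖ ≤ |t| * (2 * ‖g‖) := fun t ht => by
      have ht' : (t : ℂ) ≠ 0 := by exact_mod_cast ht
      have heq : ((t : ℂ)⁻¹ • (contCalc R (phase t) - contCalc R (phase 0))) (R g) -
          (I • (1 - R)) (R g) =
          (t : ℂ)⁻¹ • contCalc R (fun r => (phase t r - r - I * t * (1 - r)) * r) g := by
        rw [hop t, mul_apply_eq_comp]
        simp only [smul_apply, sub_apply, smul_sub, smul_smul,
          show (t : ℂ)⁻¹ * (I * t) = I by field_simp]
      rw [heq, norm_smul, norm_inv, norm_real, Real.norm_eq_abs]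
      have h1 : ‖contCalc R (fun r => (phase t r - r - I * t * (1 - r)) * r)‖ ≤ 2 * t ^ 2 :=
        norm_contCalc_le hR hR1 (by have := continuous_phase t; fun_prop) (by positivity)
          fun r hr => norm_phase_sub_sub_mul_le t hr
      calc _ ≤ |t|⁻¹ * (2 * t ^ 2 * ‖g‖) := by
            gcongr
            exact ContinuousLinearMap.le_of_opNorm_le _ h1 g
        _ = |t| * (2 * ‖g‖) := by
            rw [← sq_abs t]
            have := abs_pos.2 ht
            field_simp
    refine squeeze_zero' (Eventually.of_forall fun t => norm_nonneg _)
      (eventually_nhdsWithin_of_forall hb) ?_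
    exact (Continuous.tendsto' (by fun_prop) 0 0 (by simp)).mono_left nhdsWithin_le_nhds

/-- Every vector has a spectral measure, carried by the nonnegative half-line. -/
theorem exists_measure_resolventGroup (f : H) :
    ∃ μ : Measure ℝ, IsFiniteMeasure μ ∧ μ (Set.Iio 0) = 0 ∧
      ∀ t : ℝ, inner ℂ f (resolventGroup R t f) = ∫ x : ℝ, exp (I * t * x) ∂μ := by
  obtain ⟨ν, hfin, hν, hint⟩ := exists_measure_contCalc hR hR1 f
  have hae : ∀ᵐ r ∂ν, r ∈ Set.Icc (0 : ℝ) 1 := hν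
  have hm : Measurable fun r : ℝ => r⁻¹ - 1 := by fun_prop
  have hc : Continuous fun r : ℝ => (r : ℂ) := continuous_ofReal
  -- The change of variable is `λ = 1/r - 1`. The point `r = 0` stands for `λ = ∞` and is removed:
  -- with `0⁻¹ = 0` it would be sent to `-1`.
  refine ⟨(ν.restrict {0}ᶜ).map fun r => r⁻¹ - 1, inferInstance, ?_, fun t => ?_⟩
  · rw [Measure.map_apply hm measurableSet_Iio, ← compl_mem_ae_iff]
    filter_upwards [ae_restrict_of_ae hae, ae_restrict_mem (MeasurableSet.singleton (0 : ℝ)).compl]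
      with r hr hr0
    have hpos : 0 < r := lt_of_le_of_ne hr.1 (Ne.symm hr0)
    simp only [Set.mem_compl_iff, Set.mem_preimage, Set.mem_Iio, not_lt, sub_nonneg]
    exact (one_le_inv₀ hpos).2 hr.2
  rw [integral_map hm.aemeasurable (by fun_prop)]
  set ε : ℕ → ℝ := fun n => 1 / ((n : ℝ) + 1)
  have hε : ∀ n, 0 < ε n := fun n => by positivity
  have hε0 : Tendsto ε atTop (𝓝 0) := tendsto_one_div_add_atTop_nhds_zero_nat
  have hden : ∀ n r, 0 < |r| + ε n := fun n r => add_pos_of_nonneg_of_pos (abs_nonneg r) (hε n)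
  -- The exponential is discontinuous at `r = 0`, so `f` is approximated by `R (|R| + ε)⁻¹ f`, to
  -- which the calculus applies.
  let q : ℕ → ℝ → ℂ := fun n r => (((|r| + ε n)⁻¹ : ℝ) : ℂ)
  have hq : ∀ n, Continuous (q n) := fun n =>
    continuous_ofReal.comp ((by fun_prop : Continuous fun r : ℝ => |r| + ε n).inv₀
      fun r => (hden n r).ne')
  have hrqc : ∀ n, Continuous fun r : ℝ => (r : ℂ) * q n r := fun n => hc.mul (hq n)
  have hrqs : ∀ n, Continuous fun r : ℝ => (r : ℂ) * q n r - 1 := fun n =>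
    (hrqc n).sub continuous_const
  have hpq : ∀ n, Continuous fun r : ℝ => phase t r * q n r := fun n =>
    (continuous_phase t).mul (hq n)
  have hqn : ∀ n r, ‖q n r‖ = (|r| + ε n)⁻¹ := fun n r => by
    simp only [q, norm_real, Real.norm_eq_abs]
    exact abs_of_nonneg (inv_nonneg.2 (hden n r).le)
  have hrq : ∀ n r, |r| * ‖q n r‖ ≤ 1 := fun n r => by
    rw [hqn, ← div_eq_mul_inv, div_le_one (hden n r)]
    linarith [hε n]
  -- the operators `R (R + ε)⁻¹` converge strongly to the identity
  have hD : Tendsto (fun n => (R * contCalc R (q n)) f) atTop (𝓝 ((1 : H →L[ℂ] H) f)) := by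
    have hRq : ∀ n, R * contCalc R (q n) = contCalc R fun r => (r : ℂ) * q n r := fun n => by
      rw [contCalc_mul hc (hq n), contCalc_ofReal hR]
    refine tendsto_apply_of_denseRange (C := 1) (fun n => ?_) hd (fun g => ?_) f
    · rw [hRq]
      refine norm_contCalc_le hR hR1 (hrqc n) zero_le_one fun r _ => ?_
      rw [norm_mul, norm_real, Real.norm_eq_abs]
      exact hrq n r
    · rw [tendsto_iff_norm_sub_tendsto_zero]
      have hb : ∀ n, ‖(R * contCalc R (q n)) (R g) - (1 : H →L[ℂ] H) (R g)‖ ≤ ε n * ‖g‖ := fun n => by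
        have heq : (R * contCalc R (q n)) (R g) - (1 : H →L[ℂ] H) (R g) =
            contCalc R (fun r => ((r : ℂ) * q n r - 1) * r) g := by
          rw [contCalc_mul (hrqs n) hc,
            contCalc_sub (hrqc n) continuous_const, ← hRq, contCalc_const hR, one_smul,
            contCalc_ofReal hR]
          rfl
        rw [heq]
        refine ContinuousLinearMap.le_of_opNorm_le _ (norm_contCalc_le hR hR1
          (φ := fun r => ((r : ℂ) * q n r - 1) * r) ((hrqs n).mul hc) (hε n).le fun r hr => ?_) g
        have h1 : ((r : ℂ) * q n r - 1) * r = ((-(ε n * (r * (|r| + ε n)⁻¹)) : ℝ) : ℂ) := by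
          simp only [q]
          norm_cast
          have := (hden n r).ne'
          rw [abs_of_nonneg hr.1] at this ⊢
          field_simp
          ring
        have h2 := hrq n r
        rw [hqn] at h2
        rw [h1, norm_real, norm_neg, norm_mul, norm_mul, Real.norm_eq_abs, Real.norm_eq_abs,
          Real.norm_eq_abs, abs_of_pos (hε n), abs_of_pos (inv_pos.2 (hden n r))]
        exact mul_le_of_le_one_right (hε n).le h2
      refine squeeze_zero (fun n => norm_nonneg _) hb ?_
      simpa using hε0.mul_const ‖g‖
  have hL : Tendsto (fun n => inner ℂ f (resolventGroup R t ((R * contCalc R (q n)) f))) atTop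
      (𝓝 (inner ℂ f (resolventGroup R t f))) :=
    ((continuous_const.inner (resolventGroup R t).continuous).tendsto f).comp hD
  have heq : ∀ n, inner ℂ f (resolventGroup R t ((R * contCalc R (q n)) f)) =
      ∫ r, phase t r * q n r ∂ν := fun n => by
    rw [← hint _ (hpq n), contCalc_mul (continuous_phase t) (hq n),
      mul_apply_eq_comp, mul_apply_eq_comp, resolventGroup_apply hR hR1 hd]
  -- The integrands have modulus at most `1`; they tend to the exponential for `r > 0` and to `0` at
  -- `r = 0`, which is why removing that point loses nothing.
  refine tendsto_nhds_unique (hL.congr heq) ?_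
  rw [← integral_indicator (MeasurableSet.singleton (0 : ℝ)).compl]
  refine tendsto_integral_of_dominated_convergence (fun _ => 1)
    (fun n => (hpq n).aestronglyMeasurable) (integrable_const _)
    (fun n => Eventually.of_forall fun r => by rw [norm_mul, norm_phase]; exact hrq n r) ?_
  filter_upwards [hae] with r hr
  rcases hr.1.eq_or_lt with h0 | h0
  · simp [← h0, phase]
  · rw [Set.indicator_of_mem (by simpa using h0.ne')]
    have h1 : Tendsto (fun n => q n r) atTop (𝓝 ((r⁻¹ : ℝ) : ℂ)) := by
      refine (continuous_ofReal.tendsto _).comp ?_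
      have h2 : Tendsto (fun n => |r| + ε n) atTop (𝓝 r) := by
        simpa [abs_of_pos h0] using hε0.const_add |r|
      exact h2.inv₀ h0.ne'
    have h3 := h1.const_mul (phase t r)
    have h4 : phase t r * ((r⁻¹ : ℝ) : ℂ) = exp (I * t * ((r⁻¹ - 1 : ℝ) : ℂ)) := by
      rw [phase, mul_assoc, ← ofReal_mul, mul_inv_cancel₀ h0.ne', ofReal_one, mul_one]
    rwa [h4] at h3

end Group

end

/-! ### The Schrodinger group of a graph -/

namespace SimpleGraph

variable {V : Type*} {G : SimpleGraph V} [G.LocallyFinite]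

namespace IsSchrodingerGroup

variable {U : ℝ → GraphL2 V →L[ℂ] GraphL2 V} (hU : G.IsSchrodingerGroup U)
include hU

theorem add_apply (s t : ℝ) (f : GraphL2 V) : U (s + t) f = U s (U t f) := by
  rw [hU.map_add, mul_apply_eq_comp]

theorem comm_apply (s t : ℝ) (f : GraphL2 V) : U s (U t f) = U t (U s f) := by
  rw [← hU.add_apply, ← hU.add_apply, add_comm]

theorem zero_apply (f : GraphL2 V) : U 0 f = f := by rw [hU.map_zero, one_apply_eq_self]

theorem inner_map_map (t : ℝ) (f g : GraphL2 V) : inner ℂ (U t f) (U t g) = inner ℂ f g :=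
  LinearIsometry.inner_map_map ⟨(U t : GraphL2 V →ₗ[ℂ] GraphL2 V), hU.norm_map t⟩ f g

theorem inner_apply_left (s t : ℝ) (f g : GraphL2 V) :
    inner ℂ (U s f) (U t g) = inner ℂ f (U (t - s) g) := by
  rw [← hU.inner_map_map s f, ← hU.add_apply, add_sub_cancel]

variable {f g : GraphL2 V}

/-- `U t` commutes with the group, so it carries the derivative of one orbit to that of another. -/
theorem laplaceFun_apply (h : (g : V → ℂ) = G.laplaceFun (f : V → ℂ)) (t : ℝ) :
    (U t g : V → ℂ) = G.laplaceFun (U t f : V → ℂ) := by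
  refine (hU.generator _ _).1 ?_
  simp_rw [hU.comm_apply _ t]
  rw [← map_smul]
  exact ((U t).restrictScalars ℝ).hasFDerivAt.comp_hasDerivAt (0 : ℝ) ((hU.generator f g).2 h)

theorem hasDerivAt (h : (g : V → ℂ) = G.laplaceFun (f : V → ℂ)) (t : ℝ) :
    HasDerivAt (fun s => U s f) (I • U t g) t := by
  have h0 : HasDerivAt (fun s => U s (U t f)) (I • U t g) (t - t) := by
    rw [sub_self]
    exact (hU.generator _ _).2 (hU.laplaceFun_apply h t)
  refine (h0.comp_sub_const t t).congr_of_eventuallyEq (Filter.Eventually.of_forall fun s => ?_)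
  change U s f = U (s - t) (U t f)
  rw [← hU.add_apply, sub_add_cancel]

/-- Unitarity keeps the inner product of two orbits constant, so the generator is skew-adjoint on
its domain. -/
theorem inner_add_inner_eq_zero {f' g' : GraphL2 V} (h : HasDerivAt (fun t => U t f) g 0)
    (h' : HasDerivAt (fun t => U t f') g' 0) : inner ℂ f g' + inner ℂ g f' = 0 := by
  have h1 := h.inner ℂ h'
  simp only [hU.zero_apply, hU.inner_map_map] at h1
  exact h1.unique (hasDerivAt_const _ _)

theorem norm_sub_le (h : (g : V → ℂ) = G.laplaceFun (f : V → ℂ)) (t : ℝ) :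
    ‖U t f - f‖ ≤ |t| * ‖g‖ := by
  have h1 := convex_univ.norm_image_sub_le_of_norm_hasDerivWithin_le (f := fun s => U s f)
    (f' := fun s => I • U s g) (C := ‖g‖) (x := (0 : ℝ)) (y := t)
    (fun s _ => (hU.hasDerivAt h s).hasDerivWithinAt)
    (fun s _ => by rw [norm_smul, norm_I, one_mul, hU.norm_map]) (Set.mem_univ _) (Set.mem_univ _)
  simpa [hU.zero_apply, mul_comm] using h1

end IsSchrodingerGroup

theorem denseRange_resolvent : DenseRange G.resolvent :=
  denseRange_of_injective G.resolvent_isSelfAdjoint G.resolvent_injective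

/-- For `f` in the domain, `‖U t f - W t f‖²` has derivative zero by skewness and vanishes at `0`;
the domain is dense. -/
theorem IsSchrodingerGroup.unique {U W : ℝ → GraphL2 V →L[ℂ] GraphL2 V}
    (hU : G.IsSchrodingerGroup U) (hW : G.IsSchrodingerGroup W) : U = W := by
  ext1 t
  ext1 f
  refine (denseRange_resolvent (G := G)).induction_on (p := fun f => U t f = W t f) f
    (isClosed_eq (by fun_prop) (by fun_prop)) fun g₀ => ?_
  set f := G.resolvent g₀
  have hg : ((g₀ - f : GraphL2 V) : V → ℂ) = G.laplaceFun (f : V → ℂ) :=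
    (G.laplaceFun_resolvent g₀).symm
  set g := g₀ - f
  have hder : ∀ s, HasDerivAt (fun s => inner ℂ (U s f - W s f) (U s f - W s f)) (0 : ℂ) s :=
    fun s => by
      have h1 := (hU.hasDerivAt hg s).sub (hW.hasDerivAt hg s)
      have h2 := h1.inner ℂ h1
      have hL : ((U s g - W s g : GraphL2 V) : V → ℂ) =
          G.laplaceFun (U s f - W s f : GraphL2 V) := by
        rw [lp.coeFn_sub, lp.coeFn_sub, laplaceFun_sub, hU.laplaceFun_apply hg,
          hW.laplaceFun_apply hg]
      have h3 := (hU.generator _ _).2 hL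
      have h4 := hU.inner_add_inner_eq_zero h3 h3
      rw [smul_sub] at h4
      exact h2.congr_deriv h4
  have hc := is_const_of_deriv_eq_zero (fun s => (hder s).differentiableAt)
    (fun s => (hder s).deriv) t 0
  simp only [hU.zero_apply, hW.zero_apply, sub_self, inner_zero_left] at hc
  exact sub_eq_zero.1 (inner_self_eq_zero.1 hc)

theorem isSchrodingerGroup_resolventGroup : G.IsSchrodingerGroup (resolventGroup G.resolvent) := by
  have hR := G.resolvent_nonneg
  have hR1 := G.norm_resolvent_le
  have hd := denseRange_resolvent (G := G)
  have hdom : ∀ f g : GraphL2 V, (g : V → ℂ) = G.laplaceFun (f : V → ℂ) →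
      HasDerivAt (fun t => resolventGroup G.resolvent t f) (I • g) 0 := fun f g h => by
    have h1 := hasDerivAt_resolventGroup hR hR1 hd (f + g)
    rwa [← G.eq_resolvent_of_laplaceFun_eq h, add_sub_cancel_left] at h1
  refine ⟨resolventGroup_zero hR hR1 hd, resolventGroup_add hR hR1 hd,
    norm_resolventGroup_apply hR hR1 hd, continuous_resolventGroup hR hR1 hd,
    fun f g => ⟨fun h => ?_, hdom f g⟩⟩
  ext v
  -- Differentiating the constant inner product with the orbit of `δ_v`, which lies in the domain,
  -- reads off `g v = (L f) v`. This rules out any generator larger than the maximal `L`.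
  have h1 := h.inner ℂ (hdom (vertexDelta v) (G.laplaceDelta v) (G.laplaceFun_vertexDelta v).symm)
  have h2 : ∀ t, inner ℂ (resolventGroup G.resolvent t f)
      (resolventGroup G.resolvent t (vertexDelta v)) = inner ℂ f (vertexDelta v) := fun t =>
    LinearIsometry.inner_map_map
      ⟨(resolventGroup G.resolvent t : GraphL2 V →ₗ[ℂ] GraphL2 V),
        norm_resolventGroup_apply hR hR1 hd t⟩ _ _
  simp only [h2, resolventGroup_zero hR hR1 hd, one_apply_eq_self] at h1
  have h3 := h1.unique (hasDerivAt_const _ _)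
  rw [inner_smul_left, inner_smul_right, conj_I] at h3
  have h4 : inner ℂ f (G.laplaceDelta v) = inner ℂ g (vertexDelta v) := by
    refine mul_left_cancel₀ I_ne_zero ?_
    linear_combination h3
  rw [← inner_vertexDelta v g, ← inner_laplaceDelta, ← inner_conj_symm, ← h4, inner_conj_symm]

variable (G)

theorem isSchrodingerGroup_schrodingerGroup : G.IsSchrodingerGroup G.schrodingerGroup :=
  Classical.epsilon_spec ⟨_, isSchrodingerGroup_resolventGroup⟩

theorem exists_isSpectralMeasure (f : GraphL2 V) :
    ∃ μ : Measure ℝ, G.IsSpectralMeasure f μ ∧ μ (Set.Iio 0) = 0 := by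
  obtain ⟨μ, hfin, h0, hμ⟩ := exists_measure_resolventGroup G.resolvent_nonneg G.norm_resolvent_le
    denseRange_resolvent f
  refine ⟨μ, ⟨hfin, ?_⟩, h0⟩
  rwa [G.isSchrodingerGroup_schrodingerGroup.unique isSchrodingerGroup_resolventGroup]

end SimpleGraph

/-! ### The Jackson kernel -/

section

open FourierTransform

/-- The indicator function of `[-c, c]`. -/
noncomputable def boxFun (c : ℝ) : ℝ → ℂ := (Set.Icc (-c) c).indicator 1

/-- The convolution of `j + 1` copies of the indicator function of `[-c, c]`. -/
noncomputable def boxConv (c : ℝ) : ℕ → ℝ → ℂ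
  | 0 => boxFun c
  | j + 1 => convolution (boxConv c j) (boxFun c) (ContinuousLinearMap.mul ℂ ℂ) volume

theorem integrable_boxFun (c : ℝ) : Integrable (boxFun c) :=
  (integrable_indicator_iff measurableSet_Icc).2 (integrableOn_const (by simp))

theorem integrable_boxConv (c : ℝ) (j : ℕ) : Integrable (boxConv c j) := by
  induction j with
  | zero => exact integrable_boxFun c
  | succ j ih => exact ih.integrable_convolution _ (integrable_boxFun c)

theorem boxConv_eq_zero (c : ℝ) (j : ℕ) {x : ℝ} (hx : (j + 1) * c < |x|) : boxConv c j x = 0 := by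
  induction j generalizing x with
  | zero =>
    refine Set.indicator_of_notMem (fun h => ?_) _
    simp only [Nat.cast_zero, zero_add, one_mul] at hx
    exact absurd (abs_le.2 h) (not_le.2 hx)
  | succ j ih =>
    by_contra h
    obtain ⟨y, hy, z, hz, rfl⟩ := support_convolution_subset (L := ContinuousLinearMap.mul ℂ ℂ)
      (μ := volume) (Function.mem_support.2 h)
    have h1 : |y| ≤ (j + 1) * c := not_lt.1 fun h => hy (ih h)
    have h2 : |z| ≤ c := abs_le.2 (show z ∈ Set.Icc (-c) c from Set.mem_of_indicator_ne_zero hz)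
    push_cast at hx
    linarith [abs_add_le y z]

theorem fourier_boxFun {c : ℝ} (hc : 0 ≤ c) {w : ℝ} (hw : w ≠ 0) :
    𝓕 (boxFun c) w = ((2 * (Real.sin (c * (2 * Real.pi * w)) / (2 * Real.pi * w)) : ℝ) : ℂ) := by
  have hne : ((2 * Real.pi * w : ℝ) : ℂ) ≠ 0 := by
    exact_mod_cast mul_ne_zero (mul_ne_zero two_ne_zero Real.pi_ne_zero) hw
  set τ := 2 * Real.pi * w with hτ
  have hne' : -((τ : ℝ) : ℂ) * I ≠ 0 := mul_ne_zero (neg_ne_zero.2 hne) I_ne_zero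
  rw [Real.fourier_eq']
  have h1 : ∀ v : ℝ, exp (((-2 * Real.pi * inner ℝ v w : ℝ) : ℂ) * I) • boxFun c v =
      (Set.Icc (-c) c).indicator (fun v : ℝ => exp (-(τ : ℂ) * I * v)) v := fun v => by
    have h2 : ((-2 * Real.pi * inner ℝ v w : ℝ) : ℂ) * I = -(τ : ℂ) * I * v := by
      simp only [hτ, RCLike.inner_apply]
      push_cast
      simp
      ring
    rw [h2, boxFun]
    by_cases hv : v ∈ Set.Icc (-c) c <;> simp [hv]
  simp_rw [h1]
  rw [integral_indicator measurableSet_Icc, integral_Icc_eq_integral_Ioc,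
    ← intervalIntegral.integral_of_le (by linarith), integral_exp_mul_complex hne']
  push_cast
  rw [Complex.sin]
  have e1 : -(τ : ℂ) * I * c = -(c * τ * I) := by ring
  have e2 : -(τ : ℂ) * I * -c = c * τ * I := by ring
  have e3 : -(c * τ : ℂ) * I = -(c * τ * I) := by ring
  rw [e1, e2, e3]
  field_simp
  rw [I_sq]
  ring

theorem fourier_boxConv (c : ℝ) (j : ℕ) (w : ℝ) : 𝓕 (boxConv c j) w = 𝓕 (boxFun c) w ^ (j + 1) := by
  induction j with
  | zero => simp [boxConv]
  | succ j ih =>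
    rw [boxConv, Real.fourier_mul_convolution_eq (integrable_boxConv c j) (integrable_boxFun c), ih,
      ← pow_succ]

section

variable {n : ℕ}

theorem abs_sin_div_le (hn : 1 ≤ n) (t : ℝ) : |Real.sin (t / n) / t| ≤ 2 / (1 + |t|) := by
  have hn' : (1 : ℝ) ≤ n := by exact_mod_cast hn
  rcases eq_or_ne t 0 with rfl | ht
  · simp
  have hpos := abs_pos.2 ht
  have h1 : |Real.sin (t / n)| ≤ 1 := Real.abs_sin_le_one _
  have h2 : |Real.sin (t / n)| ≤ |t| := by
    refine Real.abs_sin_le_abs.trans ?_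
    rw [abs_div, Nat.abs_cast]
    exact div_le_self hpos.le hn'
  rw [abs_div, div_le_div_iff₀ hpos (by positivity)]
  nlinarith

/-- The integrand is at most a constant times `(1 + |t|)^{m-n}`, and `n ≥ m + 2` gives the
integrable exponent `-2`. -/
theorem integrable_sin_div_pow_mul {m : ℕ} (hnm : m + 2 ≤ n) :
    Integrable fun t : ℝ => (Real.sin (t / n) / t) ^ n * (1 + |t|) ^ m := by
  have hi : Integrable fun t : ℝ => (2 : ℝ) ^ n * (1 + ‖t‖) ^ (-2 : ℝ) :=
    (integrable_one_add_norm (by simp)).const_mul _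
  refine hi.mono (by fun_prop) (Filter.Eventually.of_forall fun t => ?_)
  have h1 : (1 : ℝ) ≤ 1 + |t| := by linarith [abs_nonneg t]
  have h0 : (0 : ℝ) < 1 + |t| := by linarith
  rw [norm_mul, norm_pow, norm_pow, Real.norm_eq_abs, Real.norm_eq_abs, abs_of_pos h0,
    Real.norm_of_nonneg (by positivity), Real.rpow_neg (by positivity), Real.rpow_two,
    Real.norm_eq_abs]
  calc |Real.sin (t / n) / t| ^ n * (1 + |t|) ^ m ≤ (2 / (1 + |t|)) ^ n * (1 + |t|) ^ (n - 2) := by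
        gcongr
        · exact abs_sin_div_le (by omega) t
        · omega
    _ = 2 ^ n * ((1 + |t|) ^ 2)⁻¹ := by
        have : (1 + |t|) ^ n = (1 + |t|) ^ (n - 2) * (1 + |t|) ^ 2 := by
          rw [← pow_add]; congr 1; omega
        rw [div_pow, this]
        field_simp

theorem integrable_sin_div_pow (hn : 2 ≤ n) : Integrable fun t : ℝ => (Real.sin (t / n) / t) ^ n := by
  simpa using integrable_sin_div_pow_mul (m := 0) hn

/-- With `c = 1/n`, the convolution of `n` boxes is supported in `[-1, 1]` and its transform is a
multiple of the sinc power. Fourier inversion at `x > 1`, where the convolution vanishes nearby and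
so is continuous, gives the claim. -/
theorem integral_sin_div_pow_mul_exp (hn : 2 ≤ n) {x : ℝ} (hx : 1 < x) :
    ∫ t : ℝ, (((Real.sin (t / n) / t) ^ n : ℝ) : ℂ) * exp (I * t * x) = 0 := by
  have hn0 : (n : ℝ) ≠ 0 := by positivity
  obtain ⟨j, rfl⟩ : ∃ j, n = j + 1 := ⟨n - 1, by omega⟩
  set N : ℝ := ((j + 1 : ℕ) : ℝ)
  set c : ℝ := N⁻¹
  have hc : 0 ≤ c := by positivity
  have hπ : (2 * Real.pi) ≠ 0 := by positivity
  have hF : ∀ w : ℝ, w ≠ 0 → 𝓕 (boxConv c j) w =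
      2 ^ (j + 1) * (((Real.sin (2 * Real.pi * w / N) / (2 * Real.pi * w)) ^ (j + 1) : ℝ) : ℂ) :=
    fun w hw => by
      rw [fourier_boxConv, fourier_boxFun hc hw, div_eq_inv_mul (2 * Real.pi * w) N]
      push_cast
      rw [mul_pow, show (c : ℂ) = (N : ℂ)⁻¹ from ofReal_inv N]
  -- At `0` the quotient takes the default value `0` instead of the limit `1/n`, so the identity
  -- holds only almost everywhere.
  have hae : ∀ᵐ w : ℝ, w ≠ 0 := by simp [ae_iff]
  have hFi : Integrable (𝓕 (boxConv c j)) := by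
    have h1 := ((integrable_sin_div_pow hn).comp_mul_left' hπ).ofReal (𝕜 := ℂ)
      |>.const_mul (2 ^ (j + 1))
    exact h1.congr (hae.mono fun w hw => (hF w hw).symm)
  have hzero : ∀ y : ℝ, 1 < y → boxConv c j y = 0 := fun y hy => boxConv_eq_zero c j (by
    have : ((j : ℝ) + 1) * c = 1 := by
      have : ((j : ℝ) + 1) = N := by simp [N]
      rw [this]; exact mul_inv_cancel₀ hn0
    rw [this]; exact hy.trans_le (le_abs_self y))
  have hcont : ContinuousAt (boxConv c j) x :=
    continuousAt_const.congr (f := fun _ => (0 : ℂ))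
      ((eventually_gt_nhds hx).mono fun y hy => (hzero y hy).symm)
  have hinv := (integrable_boxConv c j).fourierInv_fourier_eq hFi hcont
  rw [hzero x hx, Real.fourierInv_eq'] at hinv
  have hsub := Measure.integral_comp_mul_left
    (fun t : ℝ => (((Real.sin (t / N) / t) ^ (j + 1) : ℝ) : ℂ) * exp (I * t * x)) (2 * Real.pi)
  have heq : ∫ w : ℝ, exp (((2 * Real.pi * inner ℝ w x : ℝ) : ℂ) * I) • 𝓕 (boxConv c j) w =
      2 ^ (j + 1) * ∫ w : ℝ, (((Real.sin (2 * Real.pi * w / N) / (2 * Real.pi * w)) ^ (j + 1) : ℝ) : ℂ)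
        * exp (I * (2 * Real.pi * w : ℝ) * x) := by
    rw [← integral_const_mul]
    refine integral_congr_ae (hae.mono fun w hw => ?_)
    have h2 : ((2 * Real.pi * inner ℝ w x : ℝ) : ℂ) * I = I * (2 * Real.pi * w : ℝ) * x := by
      simp only [RCLike.inner_apply]
      push_cast
      simp
      ring
    simp only [hF w hw, h2, smul_eq_mul]
    ring
  rw [heq, hsub] at hinv
  simpa [hπ] using hinv

/-! ### Normalisation of the kernel and the constant. -/

namespace SimpleGraph

theorem integral_sin_div_pow_pos (hn : Even n) (hn2 : 2 ≤ n) {k : ℕ} {F : ℝ → ℝ} (hF0 : ∀ t, 0 ≤ F t)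
    (hF : ∀ t, 0 < t → 0 < F t)
    (hi : Integrable fun t : ℝ => (Real.sin (t / n) / t) ^ n * |t| ^ k * F t) :
    0 < ∫ t : ℝ, (Real.sin (t / n) / t) ^ n * |t| ^ k * F t := by
  rw [integral_pos_iff_support_of_nonneg (fun t => mul_nonneg (mul_nonneg (hn.pow_nonneg _)
    (by positivity)) (hF0 t)) hi]
  refine lt_of_lt_of_le ?_ (measure_mono (s := Set.Ioo (0 : ℝ) 1) fun t ht => ?_)
  · simp
  · have hn' : (1 : ℝ) ≤ n := by exact_mod_cast (by omega : 1 ≤ n)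
    have h1 : t / n ≤ 1 := (div_le_self ht.1.le hn').trans ht.2.le
    have h2 : 0 < Real.sin (t / n) :=
      Real.sin_pos_of_pos_of_lt_pi (div_pos ht.1 (by linarith)) (by linarith [Real.pi_gt_three])
    have h3 := ht.1
    have h4 := hF t h3
    exact Function.mem_support.2 (by positivity)

theorem integral_sin_div_pow_pos' (hn : Even n) (hn2 : 2 ≤ n) :
    0 < ∫ t : ℝ, (Real.sin (t / n) / t) ^ n := by
  simpa using integral_sin_div_pow_pos hn hn2 (k := 0) (F := 1) (fun _ => zero_le_one)
    (fun _ _ => zero_lt_one) (by simpa using integrable_sin_div_pow hn2)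

theorem jacksonKernel_nonneg (hn : Even n) (t : ℝ) : 0 ≤ jacksonKernel n t :=
  mul_nonneg (inv_nonneg.2 (integral_nonneg fun _ => hn.pow_nonneg _)) (hn.pow_nonneg _)

theorem integrable_jacksonKernel (hn2 : 2 ≤ n) : Integrable (jacksonKernel n) :=
  (integrable_sin_div_pow hn2).const_mul _

theorem integral_jacksonKernel (hn : Even n) (hn2 : 2 ≤ n) : ∫ t, jacksonKernel n t = 1 := by
  simp only [jacksonKernel]
  rw [integral_const_mul, inv_mul_cancel₀ (integral_sin_div_pow_pos' hn hn2).ne']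

theorem integral_jacksonKernel_mul_exp (hn2 : 2 ≤ n) {x : ℝ} (hx : 1 < x) :
    ∫ t : ℝ, (jacksonKernel n t : ℂ) * exp (I * t * x) = 0 := by
  have h := integral_sin_div_pow_mul_exp hn2 hx
  simp only [jacksonKernel, ofReal_mul, mul_assoc] at h ⊢
  rw [integral_const_mul, h, mul_zero]

theorem integrable_jacksonConstIntegrand {m k : ℕ} (hnm : m + 2 ≤ n) (hk : k ≤ m) :
    Integrable (jacksonConstIntegrand n m k) := by
  refine ((integrable_sin_div_pow_mul hnm).const_mul (∫ s : ℝ, (Real.sin (s / n) / s) ^ n)⁻¹).mono ?_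
    (Filter.Eventually.of_forall fun t => ?_)
  · have : Measurable (jacksonConstIntegrand n m k) := by
      unfold jacksonConstIntegrand jacksonKernel
      fun_prop
    exact this.aestronglyMeasurable
  · have h0 : 0 ≤ |t| := abs_nonneg t
    simp only [jacksonConstIntegrand, jacksonKernel, norm_mul, mul_assoc]
    refine mul_le_mul_of_nonneg_left (mul_le_mul_of_nonneg_left ?_ (norm_nonneg _)) (norm_nonneg _)
    rw [← norm_mul, Real.norm_of_nonneg (by positivity), Real.norm_of_nonneg (by positivity)]
    calc |t| ^ k * (1 + |t|) ^ (m - k) ≤ (1 + |t|) ^ k * (1 + |t|) ^ (m - k) := by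
          gcongr; linarith
      _ = (1 + |t|) ^ m := by rw [← pow_add, Nat.add_sub_cancel' hk]

theorem jacksonConst_pos {m k : ℕ} (hn : Even n) (hnm : m + 2 ≤ n) (hk : k ≤ m) :
    0 < jacksonConst n m k := by
  have hn2 : 2 ≤ n := by omega
  have ha := inv_pos.2 (integral_sin_div_pow_pos' hn hn2)
  have he : jacksonConstIntegrand n m k = fun t => (∫ s : ℝ, (Real.sin (s / n) / s) ^ n)⁻¹ *
      ((Real.sin (t / n) / t) ^ n * |t| ^ k * (1 + |t|) ^ (m - k)) := by
    ext t
    simp only [jacksonConstIntegrand, jacksonKernel, mul_assoc]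
  have hi := integrable_jacksonConstIntegrand hnm hk
  rw [he] at hi
  rw [jacksonConst, he, integral_const_mul]
  exact mul_pos ha (integral_sin_div_pow_pos hn hn2 (fun t => by positivity)
    (fun t _ => by positivity) ((integrable_const_mul_iff (isUnit_iff_ne_zero.2 ha.ne') _).1 hi))

end SimpleGraph

end

end

/-! ### Averages of the Schrodinger group -/

/-- Fubini's theorem for the Fourier transform of an integrable function, tested against a finite
measure. -/
theorem integral_mul_integral_exp_mul {κ : ℝ → ℂ} (hκ : Integrable κ) {μ : Measure ℝ}
    [IsFiniteMeasure μ] {g : ℝ → ℂ} (hg : Integrable g μ) :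
    ∫ b : ℝ, κ b * ∫ x : ℝ, exp (I * b * x) * g x ∂μ =
      ∫ x : ℝ, (∫ b : ℝ, κ b * exp (I * b * x)) * g x ∂μ := by
  simp_rw [← integral_const_mul, ← integral_mul_const]
  rw [integral_integral_swap]
  · simp_rw [mul_assoc]
  · have h1 := hκ.mul_prod hg
    have h2 := h1.bdd_mul (f := fun p : ℝ × ℝ => exp (I * p.1 * p.2)) (c := 1)
      (by fun_prop) (Filter.Eventually.of_forall fun p => (norm_exp_I_mul_mul _ _).le)
    refine h2.congr (Filter.Eventually.of_forall fun p => ?_)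
    simp only [Function.uncurry]
    ring

theorem continuous_integral_mul_exp {κ : ℝ → ℂ} (hκ : Integrable κ) :
    Continuous fun x : ℝ => ∫ b : ℝ, κ b * exp (I * b * x) := by
  refine continuous_of_dominated (bound := fun b => ‖κ b‖) (fun x => ?_) (fun x => ?_) hκ.norm ?_
  · exact hκ.aestronglyMeasurable.mul (by fun_prop)
  · refine Filter.Eventually.of_forall fun b => ?_
    rw [norm_mul, norm_exp_I_mul_mul, mul_one]
  · exact Filter.Eventually.of_forall fun b => by fun_prop

theorem norm_integral_mul_exp_le {κ : ℝ → ℂ} (x : ℝ) :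
    ‖∫ b : ℝ, κ b * exp (I * b * x)‖ ≤ ∫ b, ‖κ b‖ := by
  refine (norm_integral_le_integral_norm _).trans_eq ?_
  simp_rw [norm_mul, norm_exp_I_mul_mul, mul_one]

namespace SimpleGraph

variable {V : Type*} {G : SimpleGraph V} [G.LocallyFinite]

namespace IsSchrodingerGroup

variable {U : ℝ → GraphL2 V →L[ℂ] GraphL2 V} (hU : G.IsSchrodingerGroup U)
include hU

theorem integrable_smul {κ : ℝ → ℂ} (hκ : Integrable κ) (f : GraphL2 V) :
    Integrable fun t => κ t • U t f :=
  hκ.smul_bdd ‖f‖ (hU.continuous f).aestronglyMeasurable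
    (Filter.Eventually.of_forall fun t => (hU.norm_map t f).le)

/-- The correlation of a vector with its average over the group. -/
theorem inner_apply_integral_smul {f : GraphL2 V} {μ : Measure ℝ} [IsFiniteMeasure μ]
    (hμ : ∀ t : ℝ, inner ℂ f (U t f) = ∫ x : ℝ, exp (I * t * x) ∂μ) {κ : ℝ → ℂ} (hκ : Integrable κ)
    (s : ℝ) :
    inner ℂ f (U s (∫ b, κ b • U b f)) =
      ∫ x : ℝ, exp (I * s * x) * (∫ b : ℝ, κ b * exp (I * b * x)) ∂μ := by
  have hint := hU.integrable_smul hκ f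
  rw [← (U s).integral_comp_comm hint, ← integral_inner ((U s).integrable_comp hint)]
  have h1 : ∀ b, inner ℂ f (U s (κ b • U b f)) =
      κ b * ∫ x : ℝ, exp (I * b * x) * exp (I * s * x) ∂μ := fun b => by
    rw [map_smul, inner_smul_right, ← hU.add_apply, hμ]
    congr 2 with x
    rw [← Complex.exp_add]
    push_cast
    ring_nf
  simp_rw [h1]
  rw [integral_mul_integral_exp_mul hκ]
  · simp_rw [mul_comm]
  · exact Integrable.of_bound (by fun_prop) 1
      (Filter.Eventually.of_forall fun x => (norm_exp_I_mul_mul _ _).le)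

/-- Two applications of Fubini, one for each slot of the inner product, turn the average into the
multiplier `∫ κ(b) e^{ibx} db`, so the new spectral measure has its squared modulus as density. -/
theorem inner_integral_smul_apply {f : GraphL2 V} {μ : Measure ℝ} [IsFiniteMeasure μ]
    (hμ : ∀ t : ℝ, inner ℂ f (U t f) = ∫ x : ℝ, exp (I * t * x) ∂μ) {κ : ℝ → ℂ} (hκ : Integrable κ)
    (t : ℝ) :
    inner ℂ (∫ b, κ b • U b f) (U t (∫ b, κ b • U b f)) =
      ∫ x : ℝ, (‖∫ b : ℝ, κ b * exp (I * b * x)‖ ^ 2 : ℝ) * exp (I * t * x) ∂μ := by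
  set F := ∫ b, κ b • U b f with hF
  set K : ℝ → ℂ := fun x => ∫ b : ℝ, κ b * exp (I * b * x) with hK
  have hKc : Continuous K := continuous_integral_mul_exp hκ
  have hint := hU.integrable_smul hκ f
  have h1 : ∀ a, inner ℂ (U t F) (κ a • U a f) =
      κ a * ∫ x : ℝ, exp (I * a * x) * starRingEnd ℂ (exp (I * t * x) * K x) ∂μ := fun a => by
    rw [inner_smul_right, ← inner_conj_symm, hU.inner_apply_left,
      hU.inner_apply_integral_smul hμ hκ, ← integral_conj]
    congr 2 with x
    simp only [map_mul, ← exp_conj, conj_I, conj_ofReal]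
    rw [← mul_assoc, ← Complex.exp_add]
    congr 2
    push_cast
    ring
  rw [← inner_conj_symm]
  nth_rewrite 2 [hF]
  rw [← integral_inner hint]
  simp_rw [h1]
  rw [integral_mul_integral_exp_mul hκ, ← integral_conj]
  · congr 1 with x
    simp only [map_mul, conj_conj]
    rw [← normSq_eq_norm_sq, normSq_eq_conj_mul_self]
    ring
  · refine Integrable.of_bound (Continuous.aestronglyMeasurable (by fun_prop)) (∫ b, ‖κ b‖)
      (Filter.Eventually.of_forall fun x => ?_)
    rw [RCLike.norm_conj, norm_mul, norm_exp_I_mul_mul, one_mul]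
    exact norm_integral_mul_exp_le x

end IsSchrodingerGroup

/-- Averages against a function whose Fourier transform vanishes beyond `ω` are in the Paley-Wiener
space. -/
theorem integral_smul_mem_paleyWiener (f : GraphL2 V) {κ : ℝ → ℂ} (hκ : Integrable κ) {ω : ℝ}
    (h : ∀ x : ℝ, ω < x → ∫ b : ℝ, κ b * exp (I * b * x) = 0) :
    (∫ b, κ b • G.schrodingerGroup b f) ∈ G.paleyWiener ω := by
  obtain ⟨μ, ⟨hfin, hμ⟩, hμ0⟩ := G.exists_isSpectralMeasure f
  have hKc := continuous_integral_mul_exp hκ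
  set K : ℝ → ℂ := fun x => ∫ b : ℝ, κ b * exp (I * b * x) with hK
  have hm : Measurable fun x => ‖K x‖₊ ^ 2 := by fun_prop
  refine ⟨μ.withDensity fun x => ((‖K x‖₊ ^ 2 : NNReal) : ENNReal), ⟨?_, fun t => ?_⟩, ?_⟩
  · refine isFiniteMeasure_withDensity ?_
    have hle : ∀ x, ((‖K x‖₊ ^ 2 : NNReal) : ENNReal) ≤ ENNReal.ofReal ((∫ b, ‖κ b‖) ^ 2) := fun x => by
      rw [← ENNReal.ofReal_coe_nnreal]
      refine ENNReal.ofReal_le_ofReal ?_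
      push_cast
      gcongr
      exact norm_integral_mul_exp_le x
    exact ((lintegral_mono hle).trans_lt (by
      rw [lintegral_const]; exact ENNReal.mul_lt_top ENNReal.ofReal_lt_top (measure_lt_top _ _))).ne
  · rw [G.isSchrodingerGroup_schrodingerGroup.inner_integral_smul_apply hμ hκ,
      integral_withDensity_eq_integral_smul hm]
    congr 1 with x
  · rw [withDensity_apply _ measurableSet_Icc.compl, setLIntegral_eq_zero_iff
      measurableSet_Icc.compl hm.coe_nnreal_ennreal]
    -- The complement of `[0, ω]` splits into the negative half-line, null for `μ`, and `x > ω`,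
    -- where the density vanishes.
    have h0 : ∀ᵐ x ∂μ, x ∉ Set.Iio (0 : ℝ) := measure_eq_zero_iff_ae_notMem.1 hμ0
    filter_upwards [h0] with x hx hx'
    have : K x = 0 := h x (by
      by_contra hlt
      exact hx' ⟨not_lt.1 hx, not_lt.1 hlt⟩)
    simp [this]

end SimpleGraph

/-! ### Differences and the approximation theorem -/

namespace SimpleGraph

variable {V : Type*} {G : SimpleGraph V} [G.LocallyFinite]

namespace IsSchrodingerGroup

variable {U : ℝ → GraphL2 V →L[ℂ] GraphL2 V} (hU : G.IsSchrodingerGroup U)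
include hU

theorem map_natCast_mul (j : ℕ) (s : ℝ) : U (j * s) = U s ^ j := by
  induction j with
  | zero => simp [hU.map_zero]
  | succ j ih => rw [Nat.cast_succ, add_one_mul, hU.map_add, ih, pow_succ]

theorem opNorm_le (t : ℝ) : ‖U t‖ ≤ 1 :=
  ContinuousLinearMap.opNorm_le_bound _ zero_le_one fun f => by rw [one_mul, hU.norm_map]

theorem opNorm_sub_one_pow_le (m : ℕ) (s : ℝ) (f : GraphL2 V) :
    ‖((U s - 1) ^ m) f‖ ≤ 2 ^ m * ‖f‖ := by
  induction m with
  | zero => simp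
  | succ m ih =>
    rw [pow_succ', mul_apply_eq_comp, sub_apply, one_apply_eq_self]
    calc _ ≤ ‖U s (((U s - 1) ^ m) f)‖ + ‖((U s - 1) ^ m) f‖ := _root_.norm_sub_le _ _
      _ ≤ 2 ^ (m + 1) * ‖f‖ := by rw [hU.norm_map, pow_succ]; linarith

theorem laplaceFun_sub_one_pow {f g : GraphL2 V} (h : (g : V → ℂ) = G.laplaceFun (f : V → ℂ))
    (s : ℝ) (m : ℕ) :
    (((U s - 1) ^ m) g : V → ℂ) = G.laplaceFun (((U s - 1) ^ m) f : V → ℂ) := by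
  induction m with
  | zero => simpa using h
  | succ m ih =>
    simp only [pow_succ', mul_apply_eq_comp, sub_apply, one_apply_eq_self]
    rw [lp.coeFn_sub, lp.coeFn_sub, laplaceFun_sub, ← hU.laplaceFun_apply ih, ← ih]

/-- Each factor `U s - 1` obeys the mean value bound `‖U s f - f‖ ≤ |s| ‖L f‖`, and `L` commutes
with the remaining factors. -/
theorem norm_sub_one_pow_add_le (s : ℝ) (m k : ℕ) (f : GraphL2 V) (hf : f ∈ G.laplaceDomain k) :
    ‖((U s - 1) ^ (m + k)) f‖ ≤ |s| ^ k * ‖((U s - 1) ^ m) (G.laplacePow k f hf)‖ := by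
  induction k generalizing f with
  | zero => simp [show G.laplacePow 0 f hf = f from lp.ext rfl]
  | succ k ih =>
    let g : GraphL2 V := ⟨G.laplaceFun (f : V → ℂ), hf 1 (by omega)⟩
    have hg : g ∈ G.laplaceDomain k := fun j hj => hf (j + 1) (by omega)
    have h1 := hU.norm_sub_le (hU.laplaceFun_sub_one_pow (f := f) (g := g) rfl s (m + k)) s
    rw [show m + (k + 1) = (m + k) + 1 by ring, pow_succ', mul_apply_eq_comp, sub_apply,
      one_apply_eq_self]
    calc _ ≤ |s| * ‖((U s - 1) ^ (m + k)) g‖ := h1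
      _ ≤ |s| * (|s| ^ k * ‖((U s - 1) ^ m) (G.laplacePow k g hg)‖) := by
          gcongr; exact ih g hg
      _ = |s| ^ (k + 1) * ‖((U s - 1) ^ m) (G.laplacePow (k + 1) f hf)‖ := by
          rw [← mul_assoc, pow_succ']; rfl

/-- The geometric sum factors `U s ^ N - 1` as `S (U s - 1)`, where `S` is a sum of `N`
contractions. -/
theorem norm_sub_one_pow_natCast_mul_le (m N : ℕ) (s : ℝ) (f : GraphL2 V) :
    ‖((U (N * s) - 1) ^ m) f‖ ≤ (N : ℝ) ^ m * ‖((U s - 1) ^ m) f‖ := by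
  set S := ∑ i ∈ Finset.range N, U s ^ i
  have hS : ‖S‖ ≤ N := by
    refine (norm_sum_le_of_le _ (n := fun _ => (1 : ℝ)) fun i _ => ?_).trans (by simp)
    rw [← hU.map_natCast_mul]
    exact hU.opNorm_le _
  have hcomm : Commute S (U s - 1) :=
    Commute.sum_left _ _ _ fun i _ => ((Commute.refl (U s)).pow_left i).sub_right (Commute.one_right _)
  rw [hU.map_natCast_mul, ← geom_sum_mul, hcomm.mul_pow, mul_apply_eq_comp]
  have hSm : ‖S ^ m‖ ≤ (N : ℝ) ^ m := by
    induction m with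
    | zero =>
      rw [pow_zero, pow_zero]
      exact ContinuousLinearMap.norm_id_le
    | succ m ih =>
      rw [pow_succ, pow_succ]
      exact (norm_mul_le _ _).trans (by gcongr)
  exact (S ^ m).le_of_opNorm_le hSm _

end IsSchrodingerGroup

/-! ### Differences bounded by the modulus of continuity. -/

variable (G)

theorem schrodingerDiff_eq (m : ℕ) (s : ℝ) (f : GraphL2 V) :
    G.schrodingerDiff m s f = ((G.schrodingerGroup s - 1) ^ m) f := by
  have hU := G.isSchrodingerGroup_schrodingerGroup
  rw [sub_eq_add_neg, (Commute.neg_one_right (G.schrodingerGroup s)).add_pow, schrodingerDiff,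
    sum_apply]
  refine Finset.sum_congr rfl fun j hj => ?_
  have hj' : j ≤ m := Nat.lt_succ_iff.1 (Finset.mem_range.1 hj)
  have hs : ((-1 : ℂ)) ^ (m + j) = (-1) ^ (m - j) := by
    rw [show m + j = (m - j) + 2 * j by omega, pow_add, pow_mul]
    simp
  have ho : G.schrodingerGroup s ^ j * (-1) ^ (m - j) * ((m.choose j : ℕ) : GraphL2 V →L[ℂ] GraphL2 V)
      = ((-1 : ℂ) ^ (m + j) * (m.choose j : ℂ)) • G.schrodingerGroup (j * s) := by
    rw [hU.map_natCast_mul, hs]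
    rcases Nat.even_or_odd (m - j) with h | h <;>
    simp [h.neg_one_pow, ← nsmul_eq_mul', Nat.cast_smul_eq_nsmul]
  rw [ho, smul_apply]

theorem norm_schrodingerDiff_le (m : ℕ) (s : ℝ) (f : GraphL2 V) :
    ‖G.schrodingerDiff m s f‖ ≤ 2 ^ m * ‖f‖ := by
  rw [schrodingerDiff_eq]
  exact G.isSchrodingerGroup_schrodingerGroup.opNorm_sub_one_pow_le m s f

theorem norm_schrodingerDiff_le_modulus (m : ℕ) (f : GraphL2 V) {s τ : ℝ} (hτ : |τ| ≤ s) :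
    ‖G.schrodingerDiff m τ f‖ ≤ G.schrodingerModulus m f s :=
  le_ciSup (f := fun τ : {τ : ℝ // |τ| ≤ s} => ‖G.schrodingerDiff m (τ : ℝ) f‖)
    ⟨2 ^ m * ‖f‖, by rintro _ ⟨τ, rfl⟩; exact G.norm_schrodingerDiff_le m τ f⟩ ⟨τ, hτ⟩

/-- Dilating the step of a difference. -/
theorem norm_schrodingerDiff_div_le (m : ℕ) (f : GraphL2 V) {ω : ℝ} (hω : 0 < ω) (t : ℝ) :
    ‖G.schrodingerDiff m (t / ω) f‖ ≤ (1 + |t|) ^ m * G.schrodingerModulus m f (1 / ω) := by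
  -- Chosen so that `|t| ≤ N ≤ 1 + |t|` and `N > 0`: `N` steps of length at most `1/ω` cover `t/ω`,
  -- and the cost `N^m` is at most `(1 + |t|)^m`.
  set N : ℕ := ⌊|t|⌋₊ + 1
  have hN : (0 : ℝ) < N := by positivity
  have h1 : |t| ≤ N := by simpa [N] using (Nat.lt_floor_add_one |t|).le
  have h2 : (N : ℝ) ≤ 1 + |t| := by
    have := Nat.floor_le (abs_nonneg t)
    push_cast [N]
    linarith
  have hs : t / ω = N * (t / (N * ω)) := by field_simp
  have hτ : |t / (N * ω)| ≤ 1 / ω := by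
    rw [abs_div, abs_of_pos (mul_pos hN hω), ← div_div]
    gcongr
    exact (div_le_one hN).2 h1
  have h3 := G.norm_schrodingerDiff_le_modulus m f hτ
  rw [schrodingerDiff_eq] at h3 ⊢
  rw [hs]
  refine (G.isSchrodingerGroup_schrodingerGroup.norm_sub_one_pow_natCast_mul_le m N _ f).trans ?_
  gcongr

theorem norm_schrodingerDiff_div_le_of_mem {m k : ℕ} (hk : k ≤ m) (f : GraphL2 V)
    (hf : f ∈ G.laplaceDomain k) {ω : ℝ} (hω : 0 < ω) (t : ℝ) :
    ‖G.schrodingerDiff m (t / ω) f‖ ≤ |t| ^ k * (1 + |t|) ^ (m - k) *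
      (G.schrodingerModulus (m - k) (G.laplacePow k f hf) (1 / ω) / ω ^ k) := by
  have h1 := G.isSchrodingerGroup_schrodingerGroup.norm_sub_one_pow_add_le (t / ω) (m - k) k f hf
  rw [Nat.sub_add_cancel hk, ← schrodingerDiff_eq, ← schrodingerDiff_eq] at h1
  have h2 := G.norm_schrodingerDiff_div_le (m - k) (G.laplacePow k f hf) hω t
  calc _ ≤ |t / ω| ^ k * ((1 + |t|) ^ (m - k) * _) := h1.trans (by gcongr)
    _ = _ := by
      rw [abs_div, abs_of_pos hω, div_pow]
      ring

theorem continuous_schrodingerDiff_div (m : ℕ) (ω : ℝ) (f : GraphL2 V) :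
    Continuous fun t : ℝ => G.schrodingerDiff m (t / ω) f := by
  unfold schrodingerDiff
  have hc := G.isSchrodingerGroup_schrodingerGroup.continuous f
  refine continuous_finsetSum _ fun j _ => ?_
  have : Continuous fun t : ℝ => G.schrodingerGroup (j * (t / ω)) f := hc.comp (by fun_prop)
  fun_prop

/-! ### The filter: approximation error and band limitation. -/

variable {n : ℕ}

theorem integrable_kernel_smul (hn2 : 2 ≤ n) {F : ℝ → GraphL2 V} (hF : Continuous F) {C : ℝ}
    (hC : ∀ t, ‖F t‖ ≤ C) : Integrable fun t => (jacksonKernel n t : ℂ) • F t := by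
  change Integrable ((fun t => (jacksonKernel n t : ℂ)) • F)
  exact (integrable_jacksonKernel hn2).ofReal.smul_bdd C hF.aestronglyMeasurable
    (Filter.Eventually.of_forall hC)

theorem integrable_filterIntegrand (hn2 : 2 ≤ n) (m : ℕ) (ω : ℝ) (f : GraphL2 V) :
    Integrable (G.filterIntegrand n m ω f) := by
  refine integrable_kernel_smul hn2 (C := 2 ^ m * ‖f‖ + ‖f‖)
    (by have := G.continuous_schrodingerDiff_div m ω f; fun_prop) fun t => ?_
  refine (norm_add_le _ _).trans (add_le_add_left ?_ _)
  rw [norm_smul, norm_pow, norm_neg, norm_one, one_pow, one_mul]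
  exact G.norm_schrodingerDiff_le m _ f

theorem filterOp_sub_eq (hn : Even n) (hn2 : 2 ≤ n) (m : ℕ) (ω : ℝ) (f : GraphL2 V) :
    G.filterOp n m ω f - f =
      ∫ t, (jacksonKernel n t : ℂ) • ((-1 : ℂ) ^ (m + 1) • G.schrodingerDiff m (t / ω) f) := by
  have h1 : ∫ t, (jacksonKernel n t : ℂ) • f = f := by
    have h0 : ∫ t, (jacksonKernel n t : ℂ) = ((∫ t, jacksonKernel n t : ℝ) : ℂ) := integral_ofReal
    rw [integral_smul_const, h0, integral_jacksonKernel hn hn2, ofReal_one, one_smul]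
  nth_rewrite 2 [← h1]
  rw [filterOp, ← integral_sub (G.integrable_filterIntegrand hn2 m ω f)
    (integrable_kernel_smul hn2 continuous_const fun _ => le_rfl)]
  congr 1 with t
  rw [filterIntegrand, smul_add, add_sub_cancel_right]

theorem norm_filterOp_sub_le (hn : Even n) {m k : ℕ} (hnm : m + 2 ≤ n) (hk : k ≤ m) {ω : ℝ}
    (hω : 0 < ω) (f : GraphL2 V) (hf : f ∈ G.laplaceDomain k) :
    ‖G.filterOp n m ω f - f‖ ≤ jacksonConst n m k / ω ^ k *
      G.schrodingerModulus (m - k) (G.laplacePow k f hf) (1 / ω) := by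
  rw [G.filterOp_sub_eq hn (by omega), div_mul_eq_mul_div, mul_div_assoc, jacksonConst,
    ← integral_mul_const]
  refine norm_integral_le_of_norm_le ((integrable_jacksonConstIntegrand hnm hk).mul_const _)
    (Filter.Eventually.of_forall fun t => ?_)
  rw [norm_smul, norm_smul, norm_pow, norm_neg, norm_one, one_pow, one_mul, norm_real,
    Real.norm_of_nonneg (jacksonKernel_nonneg hn t), jacksonConstIntegrand, mul_assoc, mul_assoc]
  refine mul_le_mul_of_nonneg_left ?_ (jacksonKernel_nonneg hn t)
  rw [← mul_assoc]
  exact G.norm_schrodingerDiff_div_le_of_mem hk f hf hω t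

/-- The term `j = 0` of the signed difference is `-f` and cancels; only nonzero multiples of the
step survive, so each can be rescaled to a dilated kernel. -/
theorem neg_one_pow_smul_schrodingerDiff_add (m : ℕ) (s : ℝ) (f : GraphL2 V) :
    (-1 : ℂ) ^ (m + 1) • G.schrodingerDiff m s f + f =
      ∑ j ∈ Finset.range m, ((-1 : ℂ) ^ j * (m.choose (j + 1) : ℂ)) •
        G.schrodingerGroup ((j + 1 : ℕ) * s) f := by
  have hsq : ((-1 : ℂ)) ^ m * (-1) ^ m = 1 := by rw [← mul_pow]; simp
  rw [schrodingerDiff, Finset.sum_range_succ', smul_add, add_assoc]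
  have h0 : (-1 : ℂ) ^ (m + 1) • (((-1 : ℂ) ^ (m + 0) * (m.choose 0 : ℂ)) •
      G.schrodingerGroup (((0 : ℕ) : ℝ) * s) f) + f = 0 := by
    rw [Nat.cast_zero, zero_mul, G.isSchrodingerGroup_schrodingerGroup.zero_apply, smul_smul,
      show (-1 : ℂ) ^ (m + 1) * ((-1 : ℂ) ^ (m + 0) * (m.choose 0 : ℂ)) = -1 by
        rw [Nat.choose_zero_right, pow_succ, add_zero]; linear_combination -hsq]
    simp
  rw [h0, add_zero, Finset.smul_sum]
  refine Finset.sum_congr rfl fun j _ => ?_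
  rw [smul_smul]
  congr 1
  rw [pow_succ, pow_add, pow_succ]
  linear_combination (-1) ^ j * (m.choose (j + 1) : ℂ) * hsq

theorem integral_dilate_smul {E : Type*} [NormedAddCommGroup E] [NormedSpace ℂ E] {c : ℝ} (hc : 0 < c)
    (κ : ℝ → ℂ) (F : ℝ → E) : ∫ b, ((c : ℂ) * κ (c * b)) • F b = ∫ t, κ t • F (t / c) := by
  have h := Measure.integral_comp_mul_left (fun t => κ t • F (t / c)) c
  simp only [mul_div_cancel_left₀ _ hc.ne'] at h
  simp only [mul_smul]
  rw [integral_smul, h, abs_of_pos (inv_pos.2 hc), coe_smul, smul_smul, mul_inv_cancel₀ hc.ne',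
    one_smul]

theorem filterOp_mem_paleyWiener (hn2 : 2 ≤ n) (m : ℕ) {ω : ℝ} (hω : 0 < ω) (f : GraphL2 V) :
    G.filterOp n m ω f ∈ G.paleyWiener ω := by
  have hU := G.isSchrodingerGroup_schrodingerGroup
  set c : ℕ → ℂ := fun j => (-1 : ℂ) ^ j * (m.choose (j + 1) : ℂ)
  -- The substitution `b = (j + 1) t / ω` dilates the kernel by `a j`. Its transform at `x` is that
  -- of `h` at `x / a j`, which exceeds `1` when `x > ω`, since `a j ≤ ω`.
  set a : ℕ → ℝ := fun j => ω / (j + 1 : ℕ)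
  have ha : ∀ j, 0 < a j := fun j => by positivity
  set κ : ℕ → ℝ → ℂ := fun j b => (a j : ℂ) * (jacksonKernel n (a j * b) : ℂ)
  have hκ : ∀ j, Integrable (κ j) := fun j =>
    (((integrable_jacksonKernel hn2).comp_mul_left' (ha j).ne').ofReal (𝕜 := ℂ)).const_mul _
  have hsum : Integrable fun b => ∑ j ∈ Finset.range m, c j * κ j b :=
    integrable_finsetSum _ fun j _ => (hκ j).const_mul _
  have hdiv : ∀ (j : ℕ) (t : ℝ), ((j + 1 : ℕ) : ℝ) * (t / ω) = t / a j := fun j t => by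
    have : ((j + 1 : ℕ) : ℝ) ≠ 0 := by positivity
    simp only [a]
    field_simp
  have hΔ : ∀ t, (-1 : ℂ) ^ (m + 1) • G.schrodingerDiff m (t / ω) f + f =
      ∑ j ∈ Finset.range m, c j • G.schrodingerGroup (t / a j) f := fun t => by
    rw [neg_one_pow_smul_schrodingerDiff_add]
    simp only [hdiv, c]
  have hP : G.filterOp n m ω f =
      ∫ b, (∑ j ∈ Finset.range m, c j * κ j b) • G.schrodingerGroup b f := by
    simp only [filterOp, filterIntegrand, hΔ, Finset.smul_sum, Finset.sum_smul]
    rw [integral_finsetSum, integral_finsetSum]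
    · refine Finset.sum_congr rfl fun j _ => ?_
      simp only [mul_smul (c j), smul_comm _ (c j)]
      rw [integral_smul, integral_smul]
      exact congrArg (c j • ·) (integral_dilate_smul (ha j) (fun t => (jacksonKernel n t : ℂ))
        fun b => G.schrodingerGroup b f).symm
    · exact fun j _ => hU.integrable_smul ((hκ j).const_mul _) f
    · intro j _
      have hcont : Continuous fun t : ℝ => G.schrodingerGroup (t / a j) f :=
        (hU.continuous f).comp (continuous_id.div_const (a j))
      refine integrable_kernel_smul hn2 (C := ‖c j‖ * ‖f‖) (by fun_prop) fun t => ?_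
      rw [norm_smul, hU.norm_map]
  rw [hP]
  refine G.integral_smul_mem_paleyWiener f hsum fun x hx => ?_
  simp only [Finset.sum_mul]
  rw [integral_finsetSum]
  · refine Finset.sum_eq_zero fun j _ => ?_
    simp only [mul_assoc (c j)]
    rw [integral_const_mul]
    have h1 := integral_dilate_smul (ha j) (fun t => (jacksonKernel n t : ℂ)) fun b => exp (I * b * x)
    have h2 : 1 < x / a j := by
      rw [one_lt_div (ha j)]
      refine lt_of_le_of_lt (div_le_self hω.le ?_) hx
      exact_mod_cast Nat.succ_le_succ (Nat.zero_le j)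
    have h3 := integral_jacksonKernel_mul_exp hn2 h2
    simp only [smul_eq_mul] at h1
    rw [h1]
    refine (mul_eq_zero_of_right _ ?_)
    rw [← h3]
    congr 1 with t
    push_cast
    ring_nf
  · intro j _
    refine ((((hκ j).const_mul (c j)).smul_bdd 1 (f := fun b : ℝ => exp (I * b * x))) (by fun_prop)
      (Filter.Eventually.of_forall fun b => (norm_exp_I_mul_mul _ _).le)).congr ?_
    exact Filter.Eventually.of_forall fun b => rfl

theorem bestApprox_le (f : GraphL2 V) {ω : ℝ} {g : GraphL2 V} (hg : g ∈ G.paleyWiener ω) :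
    G.bestApprox f ω ≤ ‖g - f‖ := by
  rw [norm_sub_rev]
  exact ciInf_le (f := fun g : G.paleyWiener ω => ‖f - (g : GraphL2 V)‖)
    ⟨0, by rintro _ ⟨g, rfl⟩; exact norm_nonneg _⟩ ⟨g, hg⟩

end SimpleGraph

theorem theorem4p3 {V : Type*} (G : SimpleGraph V) [G.LocallyFinite]
    (n m k : ℕ) (hn : Even n) (hnm : m + 2 ≤ n) (hk : k ≤ m) :
    G.IsSchrodingerGroup G.schrodingerGroup ∧
    Integrable (SimpleGraph.jacksonConstIntegrand n m k) ∧
    0 < SimpleGraph.jacksonConst n m k ∧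
    ∀ ω : ℝ, 0 < ω → ∀ f : GraphL2 V,
      Integrable (G.filterIntegrand n m ω f) ∧
      G.filterOp n m ω f ∈ G.paleyWiener ω ∧
      G.bestApprox f ω ≤ ‖G.filterOp n m ω f - f‖ ∧
      ∀ hf : f ∈ G.laplaceDomain k,
        ‖G.filterOp n m ω f - f‖ ≤
          SimpleGraph.jacksonConst n m k / ω ^ k *
            G.schrodingerModulus (m - k) (G.laplacePow k f hf) (1 / ω) := by
  have hn2 : 2 ≤ n := by omega
  refine ⟨G.isSchrodingerGroup_schrodingerGroup,
    SimpleGraph.integrable_jacksonConstIntegrand hnm hk, SimpleGraph.jacksonConst_pos hn hnm hk,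
    fun ω hω f => ?_⟩
  have hPW := G.filterOp_mem_paleyWiener hn2 m hω f
  exact ⟨G.integrable_filterIntegrand hn2 m ω f, hPW, G.bestApprox_le f hPW,
    G.norm_filterOp_sub_le hn hnm hk hω f⟩
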